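/- **Setting.** Let $p$ be a prime, $\mathbf k$ an algebraically closed field of characteristic $p$, $q=p^r$ with $r\ge 1$, and let $\mathbb F_{p^n}\subset\mathbf k$ be the subfield with $p^n$ elements. Let $(J,H,s,t)$ be a finite quiver with a compatible automorphism $a$ such that no edge joins two vertices of the same $a$-orbit. Let $I$ and $K$ be the sets of $a$-orbits of vertices and of edges, let $d_i=|i|$ for $i\in I$ and $e_\kappa=|\kappa|$ for $\kappa\in K$, and suppose that representatives $j_i\in i$ and $h_\kappa\in\kappa$ are given such that the ends of each $h_\kappa$ are among the $j_i$. Write $s(\kappa),t(\kappa)\in I$ for the orbits of the ends of $h_\kappa$, and identify $\mathbb NI$ with the $a$-invariants of $\mathbb NJ$. Let $\ell\ge 1$ be an integer that is prime to $p$, to all $d_i$ and to all $e_\kappa$. (The last condition follows from the one on the $d_i$ when $e_\kappa=\mathrm{lcm}(d_{s(\kappa)},d_{t(\kappa)})$ for all $\kappa$, as in the standard quiver attached to a Cartan datum.) For a family $V=(V_i)_{i\in I}$ of finite-dimensional $\mathbb F_{q^{d_i}}$-vector spaces put $|V|=\sum_i\dim(V_i)\,i\in\mathbb NI$, $G_V=\prod_i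 GL(V_i)$ and $$E_V=\bigoplus_{\kappa\in K}\mathrm{Hom}_{\mathbb F_{q^{d_{t(\kappa)}}}}\bigl(\mathbb F_{q^{e_\kappa}}\otimes_{\mathbb F_{q^{d_{s(\kappa)}}}}V_{s(\kappa)},\,V_{t(\kappa)}\bigr).$$ A graded subspace $W\subseteq V$ is $x$-stable ($x\in E_V$) if $x_\kappa(\mathbb F_{q^{e_\kappa}}\otimes W_{s(\kappa)})\subseteq W_{t(\kappa)}$ for all $\kappa$; then $x$ induces $x|_W\in E_W$ and $x_{V/W}\in E_{V/W}$. For a commutative ring $R$ let $\mathscr H=\bigoplus_{\nu\in\mathbb NI}\mathscr H_\nu$, where $\mathscr H_\nu$ is the module of $G_V$-invariant functions $E_V\to R$ for any $V$ with $|V|=\nu$. For a unit $\eta\in R$ (a square root of $q$) the twisted product of $f_1\in\mathscr H_{\nu_1}$ and $f_2\in\mathscr H_{\nu_2}$ is $$(f_1\circ f_2)(x)=\eta^{-m(\nu_1,\nu_2)}\sum_{W} f_1(x_{V/W})\,f_2(x|_W),\qquad m(\nu,\mu)=\sum_{j\in J}\nu_j\mu_j+\sum_{h\in H}\nu_{s(h)}\mu_{t(h)},$$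 for $x\in E_V$, $|V|=\nu_1+\nu_2$, the sum being over the $x$-stable graded subspaces $W$ of $V$ with $|W|=\nu_2$. Its unit is the function $1$ on the point $E_0$. For $\underline i=(i_1,\dots,i_n)\in I^n$ and $\underline c=(c_1,\dots,c_n)\in\mathbb N^n$ ($n\ge 0$) let $\mathbf 1_{(\underline i,\underline c)}\in\mathscr H$ be the function whose value at $x\in E_V$ is the number of flags $V=V^0\supseteq V^1\supseteq\dots\supseteq V^n=0$ of $x$-stable graded subspaces with $|V^{k-1}/V^k|=c_ki_k$ for all $k$, and put $\vartheta_{(\underline i,\underline c)}=\eta^{-N(\underline i,\underline c)}\mathbf 1_{(\underline i,\underline c)}$, where $$N(\underline i,\underline c)=\sum_{h\in H}\ \sum_{\substack{k<k'\\ s(h)\in i_k,\ t(h)\in i_{k'}}}c_kc_{k'}+\sum_{j\in J}\ \sum_{\substack{k<k'\\ j\in i_k=i_{k'}}}c_kc_{k'} .$$ Let $\mathcal F\subseteq\mathscr H$ be the $R$-submodule spanned by all $\mathbf 1_{(\underline i,\underline c)}$. Denote by $\mathscr H^\sharp,\mathcal F^\sharp,\vartheta^\sharp$ the same objects with $q$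 replaced by $q^\ell$. If $U=(U_i)$ is a family of $\mathbb F_{q^{\ell d_i}}$-vector spaces, let $R_\ell(U)$ be the family of underlying $\mathbb F_{q^{d_i}}$-vector spaces, and let $\iota_\ell\colon E_U\to E_{R_\ell(U)}$ be given by $\iota_\ell(x)_\kappa(\lambda\otimes u)=x_\kappa(\lambda\otimes u)$ for $\lambda\in\mathbb F_{q^{e_\kappa}}\subseteq\mathbb F_{q^{\ell e_\kappa}}$. Let $Q\colon\mathscr H\to\mathscr H^\sharp$ be the $R$-linear map $Q(f)=\iota_\ell^*(f)$; it vanishes on $\mathscr H_\nu$ for $\nu\notin\ell\,\mathbb NI$. **Theorem.** Fix a real square root $\varepsilon$ of $q$, let $R=\mathscr A_\ell=\mathbb Z[\varepsilon,\varepsilon^{-1}]/(\Phi_{2\ell}(\varepsilon))$ with $\Phi_{2\ell}$ the $2\ell$-th cyclotomic polynomial, and put $\varepsilon_\ell=(-1)^{\ell+1}\varepsilon^\ell$. Use $\eta=\varepsilon$ for $\mathscr H$ and $\eta=\varepsilon_\ell$ for $\mathscr H^\sharp$. Then $\mathcal F$ and $\mathcal F^\sharp$ contain the unit and are closed under $\circ$;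 one has $Q(\mathcal F)\subseteq\mathcal F^\sharp$; and $Q\colon\mathcal F\to\mathcal F^\sharp$ is a homomorphism of $\mathscr A_\ell$-algebras: it is linear, $Q(1)=1$, and $Q(f\circ g)=Q(f)\circ Q(g)$ for all $f,g\in\mathcal F$. Moreover $$Q(\vartheta_{(\underline i,\underline c)})=\vartheta^\sharp_{(\underline i,\underline c/\ell)}\ \text{ if } \ell\mid c_k \text{ for all } k,\qquad Q(\vartheta_{(\underline i,\underline c)})=0\ \text{ otherwise.}$$ -/

import Mathlib

open scoped TensorProduct

universe u v w

/-! ## Finite fields -/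

/-- The finite subfield `𝔽_{p^n}` of a field `k` of characteristic `p`: the fixed points of
`x ↦ x ^ (p ^ n)`. (It has `p ^ n` elements when `k` is algebraically closed and `0 < n`.) -/
def GF (k : Type u) [Field k] (p : ℕ) [ExpChar k p] (n : ℕ) : Subfield k :=
  (iterateFrobenius k p n).eqLocusField (RingHom.id k)

theorem mem_GF {k : Type u} [Field k] {p : ℕ} [ExpChar k p] {n : ℕ} {x : k} :
    x ∈ GF k p n ↔ x ^ p ^ n = x := Iff.rfl

theorem GF_mono (k : Type u) [Field k] (p : ℕ) [ExpChar k p] {m n : ℕ} (h : m ∣ n) :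
    GF k p m ≤ GF k p n := by
  obtain ⟨c, rfl⟩ := h
  intro x hx
  rw [mem_GF] at hx ⊢
  induction c with
  | zero => simp
  | succ c ih => rw [Nat.mul_succ, pow_add, pow_mul, ih, hx]

instance GF_finite (k : Type u) [Field k] (p : ℕ) [Fact p.Prime] [CharP k p] (n : ℕ) [NeZero n] :
    Finite (GF k p n) := by
  have h1 : 1 < p ^ n := Nat.one_lt_pow (NeZero.ne n) (Fact.out : p.Prime).one_lt
  have hp : (Polynomial.X ^ p ^ n - Polynomial.X : Polynomial k) ≠ 0 :=
    FiniteField.X_pow_card_sub_X_ne_zero k h1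
  have : {x : k | (Polynomial.X ^ p ^ n - Polynomial.X : Polynomial k).IsRoot x}.Finite :=
    Polynomial.finite_setOfPred_isRoot hp
  refine (this.subset ?_).to_subtype
  intro x hx
  have hx' : x ^ p ^ n = x := hx
  simp [hx']

/-! ## Quivers with an admissible automorphism -/

/-- A finite quiver with vertex set `J`, edge set `H` and an automorphism `a` (given by `aJ` on
vertices and by `aH` on edges) compatible with the orientation, such that no edge joins two vertices
of one `a`-orbit, together with representatives of the orbits of vertices (`rep`) and of edges
(`hrep`) chosen so that the ends of a representing edge are representing vertices. -/
structure AutQuiver (J : Type v) (H : Type w) where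
  s : H → J
  t : H → J
  aJ : Equiv.Perm J
  aH : Equiv.Perm H
  s_aH : ∀ h, s (aH h) = aJ (s h)
  t_aH : ∀ h, t (aH h) = aJ (t h)
  not_sameCycle : ∀ h, ¬ aJ.SameCycle (s h) (t h)
  rep : Quotient (Equiv.Perm.SameCycle.setoid aJ) → J
  mk_rep : ∀ i, Quotient.mk _ (rep i) = i
  hrep : Quotient (Equiv.Perm.SameCycle.setoid aH) → H
  mk_hrep : ∀ κ, Quotient.mk _ (hrep κ) = κ
  s_hrep : ∀ κ, s (hrep κ) = rep (Quotient.mk _ (s (hrep κ)))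
  t_hrep : ∀ κ, t (hrep κ) = rep (Quotient.mk _ (t (hrep κ)))

namespace AutQuiver

section Quiver

variable {J : Type v} {H : Type w} (Γ : AutQuiver J H)

/-- The set `I` of `a`-orbits of vertices. -/
def I : Type v := Quotient (Equiv.Perm.SameCycle.setoid Γ.aJ)

/-- The set of `a`-orbits of edges. -/
def K : Type w := Quotient (Equiv.Perm.SameCycle.setoid Γ.aH)

instance [Finite J] : Finite Γ.I := inferInstanceAs (Finite (Quotient _))

/-- The orbit of a vertex. -/
def cls (j : J) : Γ.I := Quotient.mk _ j

/-- The orbit of vertices from which the edges of the orbit `κ` start. -/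
def src (κ : Γ.K) : Γ.I := Γ.cls (Γ.s (Γ.hrep κ))

/-- The orbit of vertices at which the edges of the orbit `κ` end. -/
def tgt (κ : Γ.K) : Γ.I := Γ.cls (Γ.t (Γ.hrep κ))

/-- The size `d_i = (i · i) / 2` of the orbit `i`: the length of the cycle of `a` through its
representative. -/
noncomputable def d (i : Γ.I) : ℕ := Function.minimalPeriod Γ.aJ (Γ.rep i)

/-- The size of the orbit of edges `κ`. -/
noncomputable def e (κ : Γ.K) : ℕ := Function.minimalPeriod Γ.aH (Γ.hrep κ)

theorem d_src_dvd_e (κ : Γ.K) : Γ.d (Γ.src κ) ∣ Γ.e κ := by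
  apply Function.IsPeriodicPt.minimalPeriod_dvd
  have hs : Γ.rep (Γ.src κ) = Γ.s (Γ.hrep κ) := (Γ.s_hrep κ).symm
  rw [hs]
  have h := Function.isPeriodicPt_minimalPeriod Γ.aH (Γ.hrep κ)
  have hsc : Function.Semiconj Γ.s Γ.aH Γ.aJ := Γ.s_aH
  exact h.map hsc

theorem d_tgt_dvd_e (κ : Γ.K) : Γ.d (Γ.tgt κ) ∣ Γ.e κ := by
  apply Function.IsPeriodicPt.minimalPeriod_dvd
  have hs : Γ.rep (Γ.tgt κ) = Γ.t (Γ.hrep κ) := (Γ.t_hrep κ).symm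
  rw [hs]
  have h := Function.isPeriodicPt_minimalPeriod Γ.aH (Γ.hrep κ)
  have hsc : Function.Semiconj Γ.t Γ.aH Γ.aJ := Γ.t_aH
  exact h.map hsc

instance [Finite J] (i : Γ.I) : NeZero (Γ.d i) :=
  ⟨(Function.minimalPeriod_pos_of_mem_periodicPts
    (Function.Injective.mem_periodicPts Γ.aJ.injective _)).ne'⟩

/-- `m(ν, μ) = ∑_{j ∈ J} ν_j μ_j + ∑_{h ∈ H} ν_{s(h)} μ_{t(h)}` for `ν, μ ∈ ℕI ⊆ ℕJ`. -/
def m [Fintype J] [Fintype H] (ν μ : Γ.I → ℕ) : ℕ :=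
  ∑ j : J, ν (Γ.cls j) * μ (Γ.cls j) + ∑ h : H, ν (Γ.cls (Γ.s h)) * μ (Γ.cls (Γ.t h))

open Classical in
/-- `N(i, c)`: the sum of `c_a c_b` over the `h ∈ H` and `a < b` with `s(h) ∈ i_a`, `t(h) ∈ i_b`,
plus the sum of `c_a c_b` over the `j ∈ J` and `a < b` with `j ∈ i_a = i_b`. -/
noncomputable def N [Fintype J] [Fintype H] {n : ℕ} (i : Fin n → Γ.I) (c : Fin n → ℕ) : ℕ :=
  (∑ h : H, ∑ a : Fin n, ∑ b : Fin n,
    if a < b ∧ Γ.cls (Γ.s h) = i a ∧ Γ.cls (Γ.t h) = i b then c a * c b else 0) +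
  ∑ j : J, ∑ a : Fin n, ∑ b : Fin n,
    if a < b ∧ Γ.cls j = i a ∧ Γ.cls j = i b then c a * c b else 0

end Quiver

/-! ## Rational points of representation spaces

Throughout `q = p ^ r`. An object of the category of `J`-graded spaces with `𝔽_q`-structure and action
of `a` is given, on the level of rational points, by a family of vector spaces `V i`, `i ∈ I`, over
the fields `𝔽_{q ^ d_i}`. -/

section Points

variable {J : Type v} {H : Type w} (Γ : AutQuiver J H)
variable (k : Type u) [Field k] (p : ℕ) [Fact p.Prime] [CharP k p] (r : ℕ)

/-- The field `𝔽_{q ^ d_i}`, `q = p ^ r`. -/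
def Fv (i : Γ.I) : Type u := GF k p (r * Γ.d i)

/-- The field `𝔽_{q ^ e}`, `q = p ^ r`, where `e` is the size of the orbit of edges `κ`. -/
def Fe (κ : Γ.K) : Type u := GF k p (r * Γ.e κ)

noncomputable instance (i : Γ.I) : Field (Γ.Fv k p r i) :=
  inferInstanceAs (Field (GF k p (r * Γ.d i)))

noncomputable instance (κ : Γ.K) : Field (Γ.Fe k p r κ) :=
  inferInstanceAs (Field (GF k p (r * Γ.e κ)))

instance [Finite J] [NeZero r] (i : Γ.I) : Finite (Γ.Fv k p r i) :=
  inferInstanceAs (Finite (GF k p (r * Γ.d i)))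

/-- `𝔽_{q ^ e}` is an algebra over `𝔽_{q ^ d_{s(κ)}}` by inclusion. -/
noncomputable instance algSrc (κ : Γ.K) : Algebra (Γ.Fv k p r (Γ.src κ)) (Γ.Fe k p r κ) :=
  (Subfield.inclusion
    (GF_mono k p (Nat.mul_dvd_mul_left r (Γ.d_src_dvd_e κ))) : Γ.Fv k p r _ →+* Γ.Fe k p r κ).toAlgebra

/-- `𝔽_{q ^ e}` is an algebra over `𝔽_{q ^ d_{t(κ)}}` by inclusion. -/
noncomputable instance algTgt (κ : Γ.K) : Algebra (Γ.Fv k p r (Γ.tgt κ)) (Γ.Fe k p r κ) :=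
  (Subfield.inclusion
    (GF_mono k p (Nat.mul_dvd_mul_left r (Γ.d_tgt_dvd_e κ))) : Γ.Fv k p r _ →+* Γ.Fe k p r κ).toAlgebra

instance smulCommSrcTgt (κ : Γ.K) :
    SMulCommClass (Γ.Fv k p r (Γ.src κ)) (Γ.Fv k p r (Γ.tgt κ)) (Γ.Fe k p r κ) :=
  ⟨fun a b c => by simp only [Algebra.smul_def]; ring⟩

instance smulCommTgtSrc (κ : Γ.K) :
    SMulCommClass (Γ.Fv k p r (Γ.tgt κ)) (Γ.Fv k p r (Γ.src κ)) (Γ.Fe k p r κ) :=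
  ⟨fun a b c => by simp only [Algebra.smul_def]; ring⟩

variable (V : Γ.I → Type u) [∀ i, AddCommGroup (V i)] [∀ i, Module (Γ.Fv k p r i) (V i)]

/-- The space `E_V` (its rational points): families of `𝔽_{q ^ d_{t(κ)}}`-linear maps
`𝔽_{q ^ e_κ} ⊗ V_{s(κ)} → V_{t(κ)}`, the tensor product being over `𝔽_{q ^ d_{s(κ)}}`, where `κ`
runs over the orbits of edges. -/
abbrev E : Type (max u w) :=
  ∀ κ : Γ.K, Γ.Fe k p r κ ⊗[Γ.Fv k p r (Γ.src κ)] V (Γ.src κ) →ₗ[Γ.Fv k p r (Γ.tgt κ)] V (Γ.tgt κ)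

/-- Graded subspaces of `V`. -/
abbrev GrSub : Type (max u v) := ∀ i, Submodule (Γ.Fv k p r i) (V i)

/-- The standard graded space of dimension `ν ∈ ℕI`. -/
abbrev Std (ν : Γ.I → ℕ) (i : Γ.I) : Type u := Fin (ν i) → Γ.Fv k p r i

variable {Γ k p r}

/-- The linear map `𝔽_{q ^ e_κ} ⊗ A → B` attached to a balanced map. -/
noncomputable def mkHom (κ : Γ.K) {A B : Type u} [AddCommGroup A] [AddCommGroup B]
    [Module (Γ.Fv k p r (Γ.src κ)) A] [Module (Γ.Fv k p r (Γ.tgt κ)) B]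
    (b : Γ.Fe k p r κ → A → B)
    (h₁ : ∀ c c' v, b (c + c') v = b c v + b c' v) (h₂ : ∀ c v v', b c (v + v') = b c v + b c v')
    (h₃ : ∀ (a : Γ.Fv k p r (Γ.src κ)) c v, b (a • c) v = b c (a • v))
    (h₄ : ∀ (a : Γ.Fv k p r (Γ.tgt κ)) c v, b (a • c) v = a • b c v) :
    Γ.Fe k p r κ ⊗[Γ.Fv k p r (Γ.src κ)] A →ₗ[Γ.Fv k p r (Γ.tgt κ)] B :=
  let F : Γ.Fe k p r κ ⊗[Γ.Fv k p r (Γ.src κ)] A →+ B := TensorProduct.liftAddHom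
    (AddMonoidHom.mk' (fun c => AddMonoidHom.mk' (b c) (h₂ c))
      (fun c c' => AddMonoidHom.ext (h₁ c c'))) h₃
  { toFun := F
    map_add' := F.map_add
    map_smul' := by
      intro a z
      induction z using TensorProduct.induction_on with
      | zero => rw [smul_zero, map_zero, smul_zero]
      | tmul c v => exact h₄ a c v
      | add y z hy hz =>
        rw [smul_add, map_add, hy, hz, map_add, smul_add] }

@[simp] theorem mkHom_tmul (κ : Γ.K) {A B : Type u} [AddCommGroup A] [AddCommGroup B]
    [Module (Γ.Fv k p r (Γ.src κ)) A] [Module (Γ.Fv k p r (Γ.tgt κ)) B]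
    (b : Γ.Fe k p r κ → A → B) (h₁ h₂ h₃ h₄) (c : Γ.Fe k p r κ) (v : A) :
    mkHom κ b h₁ h₂ h₃ h₄ (c ⊗ₜ v) = b c v := rfl

variable {V}
variable {V' : Γ.I → Type u} [∀ i, AddCommGroup (V' i)] [∀ i, Module (Γ.Fv k p r i) (V' i)]
variable {V'' : Γ.I → Type u} [∀ i, AddCommGroup (V'' i)] [∀ i, Module (Γ.Fv k p r i) (V'' i)]

/-- `(V, x)` and `(V', x')` correspond to each other under the graded linear isomorphism `g`. For
`V = V'` this says that `x' = g x` for the action of `G_V = ∏ GL(V_i)` on `E_V`. -/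
def Intertwines (g : ∀ i, V i ≃ₗ[Γ.Fv k p r i] V' i) (x : Γ.E k p r V) (x' : Γ.E k p r V') : Prop :=
  ∀ (κ : Γ.K) (c : Γ.Fe k p r κ) (v : V (Γ.src κ)),
    x' κ (c ⊗ₜ g (Γ.src κ) v) = g (Γ.tgt κ) (x κ (c ⊗ₜ v))

theorem Intertwines.symm {g : ∀ i, V i ≃ₗ[Γ.Fv k p r i] V' i} {x : Γ.E k p r V} {x' : Γ.E k p r V'}
    (h : Intertwines g x x') : Intertwines (fun i => (g i).symm) x' x := by
  intro κ c v
  rw [LinearEquiv.eq_symm_apply, ← h, LinearEquiv.apply_symm_apply]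

theorem Intertwines.trans {g : ∀ i, V i ≃ₗ[Γ.Fv k p r i] V' i} {x : Γ.E k p r V} {x' : Γ.E k p r V'}
    {g' : ∀ i, V' i ≃ₗ[Γ.Fv k p r i] V'' i} {x'' : Γ.E k p r V''}
    (h : Intertwines g x x') (h' : Intertwines g' x' x'') :
    Intertwines (fun i => (g i).trans (g' i)) x x'' := by
  intro κ c v
  simp only [LinearEquiv.trans_apply]
  rw [h', h]

/-- Transport of `x ∈ E_V` to `E_{V'}` along a graded linear isomorphism. -/
noncomputable def transport (g : ∀ i, V i ≃ₗ[Γ.Fv k p r i] V' i) (x : Γ.E k p r V) :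
    Γ.E k p r V' := fun κ =>
  mkHom κ (fun c v => g (Γ.tgt κ) (x κ (c ⊗ₜ (g (Γ.src κ)).symm v)))
    (fun c c' v => by simp only [TensorProduct.add_tmul, map_add])
    (fun c v v' => by simp only [TensorProduct.tmul_add, map_add])
    (fun a c v => by rw [TensorProduct.smul_tmul, map_smul])
    (fun a c v => by rw [← TensorProduct.smul_tmul', map_smul, map_smul])

theorem intertwines_transport (g : ∀ i, V i ≃ₗ[Γ.Fv k p r i] V' i) (x : Γ.E k p r V) :
    Intertwines g x (transport g x) := by
  intro κ c v
  simp [transport]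

/-- A graded subspace `W` of `V` is `x`-stable. -/
def Stable (x : Γ.E k p r V) (W : Γ.GrSub k p r V) : Prop :=
  ∀ (κ : Γ.K) (c : Γ.Fe k p r κ), ∀ v ∈ W (Γ.src κ), x κ (c ⊗ₜ v) ∈ W (Γ.tgt κ)

/-- The element of `E_W` induced by `x ∈ E_V` on an `x`-stable graded subspace `W`. -/
noncomputable def restr (x : Γ.E k p r V) (W : Γ.GrSub k p r V) (hW : Stable x W) :
    Γ.E k p r (fun i => W i) := fun κ =>
  mkHom κ (fun c v => ⟨x κ (c ⊗ₜ (v : V (Γ.src κ))), hW κ c v v.2⟩)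
    (fun c c' v => by simp only [TensorProduct.add_tmul, map_add]; rfl)
    (fun c v v' => by simp only [Submodule.coe_add, TensorProduct.tmul_add, map_add]; rfl)
    (fun a c v => by simp only [TensorProduct.smul_tmul, Submodule.coe_smul])
    (fun a c v => by
      apply Subtype.ext
      simp only [← TensorProduct.smul_tmul', map_smul, Submodule.coe_smul])

/-- The element of `E_{V/W}` induced by `x ∈ E_V` if the graded subspace `W` is `x`-stable. -/
noncomputable def quot (x : Γ.E k p r V) (W : Γ.GrSub k p r V) (hW : Stable x W) :
    Γ.E k p r (fun i => V i ⧸ W i) := fun κ =>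
  mkHom κ (fun c => QuotientAddGroup.map (W (Γ.src κ)).toAddSubgroup (W (Γ.tgt κ)).toAddSubgroup
      (AddMonoidHom.mk' (fun v => x κ (c ⊗ₜ v)) (fun v v' => by simp only [TensorProduct.tmul_add, map_add]))
      (fun v hv => hW κ c v hv))
    (by
      intro c c' v
      obtain ⟨v, rfl⟩ := Submodule.mkQ_surjective _ v
      change Submodule.Quotient.mk (x κ ((c + c') ⊗ₜ v)) = 
        Submodule.Quotient.mk (x κ (c ⊗ₜ v)) + Submodule.Quotient.mk (x κ (c' ⊗ₜ v))
      rw [TensorProduct.add_tmul, map_add, Submodule.Quotient.mk_add])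
    (fun c v v' => map_add _ v v')
    (by
      intro a c v
      obtain ⟨v, rfl⟩ := Submodule.mkQ_surjective _ v
      change Submodule.Quotient.mk (x κ ((a • c) ⊗ₜ v)) = 
        Submodule.Quotient.mk (x κ (c ⊗ₜ (a • v)))
      rw [TensorProduct.smul_tmul])
    (by
      intro a c v
      obtain ⟨v, rfl⟩ := Submodule.mkQ_surjective _ v
      change Submodule.Quotient.mk (x κ ((a • c) ⊗ₜ v)) = 
        a • Submodule.Quotient.mk (x κ (c ⊗ₜ v))
      rw [← TensorProduct.smul_tmul', map_smul, Submodule.Quotient.mk_smul])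

@[simp] theorem restr_tmul (x : Γ.E k p r V) (W : Γ.GrSub k p r V) (hW : Stable x W) (κ : Γ.K)
    (c : Γ.Fe k p r κ) (v : W (Γ.src κ)) :
    (restr x W hW κ (c ⊗ₜ v) : V (Γ.tgt κ)) = x κ (c ⊗ₜ (v : V (Γ.src κ))) := rfl

@[simp] theorem quot_tmul (x : Γ.E k p r V) (W : Γ.GrSub k p r V) (hW : Stable x W) (κ : Γ.K)
    (c : Γ.Fe k p r κ) (v : V (Γ.src κ)) :
    quot x W hW κ (c ⊗ₜ (Submodule.Quotient.mk v : V (Γ.src κ) ⧸ W (Γ.src κ))) =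
      Submodule.Quotient.mk (x κ (c ⊗ₜ v)) := rfl

/-! ### Graded dimensions and coordinates -/

variable (k p r V) in
/-- The graded dimension `|V| ∈ ℕI`. -/
noncomputable def dim (i : Γ.I) : ℕ := Module.finrank (Γ.Fv k p r i) (V i)

/-- A choice of coordinates on `V`. -/
noncomputable def coord [∀ i, Finite (V i)] (i : Γ.I) :
    V i ≃ₗ[Γ.Fv k p r i] Γ.Std k p r (dim k p r V) i :=
  (Module.finBasis (Γ.Fv k p r i) (V i)).equivFun

theorem dim_eq (g : ∀ i, V i ≃ₗ[Γ.Fv k p r i] V' i) : dim k p r V = dim k p r V' :=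
  funext fun i => (g i).finrank_eq

theorem dim_std (ν : Γ.I → ℕ) : dim k p r (Γ.Std k p r ν) = ν :=
  funext fun i => by simp [dim, Std]

theorem dim_quot_add_dim [∀ i, Finite (V i)] (W : Γ.GrSub k p r V) :
    dim k p r (fun i => V i ⧸ W i) + dim k p r (fun i => W i) = dim k p r V :=
  funext fun i => Submodule.finrank_quotient_add_finrank (W i)

/-! ### The Hall algebra with coefficients in a commutative ring `R` -/

variable (Γ k p r) in
/-- The Hall algebra `R ⊗ ℋ = ⨁_ν R ⊗ ℋ_ν`, where `R ⊗ ℋ_ν` consists of the `G_V`-invariant functions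
`E_V → R` for the standard space `V` of dimension `ν`. (Here `E_V` is finite.) -/
def Hall (R : Type) [CommRing R] : Submodule R (∀ ν : Γ.I → ℕ, Γ.E k p r (Γ.Std k p r ν) → R) where
  carrier := {f | (∀ ν x x' g, Intertwines g x x' → f ν x = f ν x') ∧ {ν | ∃ x, f ν x ≠ 0}.Finite}
  zero_mem' := ⟨fun _ _ _ _ _ => rfl, by simp⟩
  add_mem' := by
    rintro f g ⟨hf, hf'⟩ ⟨hg, hg'⟩
    refine ⟨fun ν x x' u h => ?_, (hf'.union hg').subset ?_⟩
    · simp only [Pi.add_apply, hf ν x x' u h, hg ν x x' u h]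
    · rintro ν ⟨x, hx⟩
      by_contra hc
      simp only [Set.mem_union, Set.mem_ofPred_eq, not_or, not_exists, not_not] at hc
      exact hx (by simp only [Pi.add_apply, hc.1 x, hc.2 x, add_zero])
  smul_mem' := by
    rintro a f ⟨hf, hf'⟩
    refine ⟨fun ν x x' u h => ?_, hf'.subset ?_⟩
    · simp only [Pi.smul_apply, hf ν x x' u h]
    · rintro ν ⟨x, hx⟩
      exact ⟨x, fun h => hx (by simp only [Pi.smul_apply, h, smul_zero])⟩

variable {R : Type} [CommRing R]

/-- The value of an element of the Hall algebra at a point `x ∈ E_V`, for any graded space `V`. -/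
noncomputable def ev [∀ i, Finite (V i)] (f : Hall Γ k p r R) (x : Γ.E k p r V) : R :=
  f.1 (dim k p r V) (transport coord x)

theorem ev_add [∀ i, Finite (V i)] (f f' : Hall Γ k p r R) (x : Γ.E k p r V) :
    ev (f + f') x = ev f x + ev f' x := rfl

theorem ev_smul [∀ i, Finite (V i)] (a : R) (f : Hall Γ k p r R) (x : Γ.E k p r V) :
    ev (a • f) x = a * ev f x := rfl

theorem hall_congr (f : Hall Γ k p r R) {ν ν' : Γ.I → ℕ} (h : ν = ν') {x : Γ.E k p r (Γ.Std k p r ν)}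
    {x' : Γ.E k p r (Γ.Std k p r ν')} {g} (hg : Intertwines g x x') : f.1 ν x = f.1 ν' x' := by
  subst h
  exact f.2.1 ν x x' g hg

/-- `ev` does not depend on the coordinates, and is invariant under isomorphisms. -/
theorem ev_congr [∀ i, Finite (V i)] [∀ i, Finite (V' i)] (f : Hall Γ k p r R)
    {x : Γ.E k p r V} {x' : Γ.E k p r V'} {g} (hg : Intertwines g x x') : ev f x = ev f x' :=
  hall_congr f (dim_eq g)
    (((intertwines_transport coord x).symm.trans hg).trans (intertwines_transport coord x'))

theorem ev_std [Finite J] [NeZero r] (f : Hall Γ k p r R) (ν : Γ.I → ℕ)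
    (x : Γ.E k p r (Γ.Std k p r ν)) : ev f x = f.1 ν x :=
  hall_congr f (dim_std ν) (intertwines_transport coord x).symm

/-! ### Transport of graded subspaces -/

/-- The image of a graded subspace under a graded linear isomorphism. -/
noncomputable def mapGr (g : ∀ i, V i ≃ₗ[Γ.Fv k p r i] V' i) : Γ.GrSub k p r V ≃ Γ.GrSub k p r V' :=
  Equiv.piCongrRight fun i => (Submodule.orderIsoMapComap (g i)).toEquiv

theorem mapGr_apply (g : ∀ i, V i ≃ₗ[Γ.Fv k p r i] V' i) (W : Γ.GrSub k p r V) (i : Γ.I) :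
    mapGr g W i = (W i).map (g i : V i →ₗ[Γ.Fv k p r i] V' i) := rfl

theorem Intertwines.stable_iff {g : ∀ i, V i ≃ₗ[Γ.Fv k p r i] V' i} {x : Γ.E k p r V}
    {x' : Γ.E k p r V'} (h : Intertwines g x x') (W : Γ.GrSub k p r V) :
    Stable x W ↔ Stable x' (mapGr g W) := by
  constructor
  · rintro hW κ c _ ⟨v, hv, rfl⟩
    exact ⟨_, hW κ c v hv, (h κ c v).symm⟩
  · intro hW κ c v hv
    obtain ⟨w, hw, hw'⟩ := hW κ c (g _ v) ⟨v, hv, rfl⟩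
    rw [h] at hw'
    exact (g _).injective hw' ▸ hw

instance GrSub.finite [Finite J] [∀ i, Finite (V i)] : Finite (Γ.GrSub k p r V) :=
  have (i : Γ.I) : Finite (Submodule (Γ.Fv k p r i) (V i)) :=
    Finite.of_injective (fun W => (W : Set (V i))) SetLike.coe_injective
  inferInstance

instance finite_quot [∀ i, Finite (V i)] (W : Γ.GrSub k p r V) (i : Γ.I) : Finite (V i ⧸ W i) :=
  Finite.of_surjective _ (Submodule.mkQ_surjective (W i))

/-! ### The twisted multiplication -/

section Mul

variable [Fintype J] [Fintype H]

/-- The value at `x ∈ E_V` of the twisted product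
`f ∘ f' = ε ^ (-m(ν, ν')) f ⋆ f'` (`f ∈ ℋ_ν`, `f' ∈ ℋ_ν'`): a sum over the `x`-stable graded subspaces
`W` of `V`, where `f` is evaluated on `V / W` and `f'` on `W`. -/
noncomputable def mulAt (ε : Rˣ) (f f' : Hall Γ k p r R) [∀ i, Finite (V i)] (x : Γ.E k p r V) : R :=
  ∑ᶠ W : {W : Γ.GrSub k p r V // Stable x W},
    ((ε ^ (-(Γ.m (dim k p r fun i => V i ⧸ W.1 i) (dim k p r fun i => W.1 i) : ℤ)) : Rˣ) : R) *
      (ev f (quot x W.1 W.2) * ev f' (restr x W.1 W.2))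

theorem mulAt_congr (ε : Rˣ) (f f' : Hall Γ k p r R) [∀ i, Finite (V i)] [∀ i, Finite (V' i)]
    {x : Γ.E k p r V} {x' : Γ.E k p r V'} {g} (h : Intertwines g x x') :
    mulAt ε f f' x = mulAt ε f f' x' := by
  refine finsum_eq_of_bijective ((mapGr g).subtypeEquiv h.stable_iff) (Equiv.bijective _) ?_
  rintro ⟨W, hW⟩
  have hW' := (h.stable_iff W).1 hW
  let gs : ∀ i, W i ≃ₗ[Γ.Fv k p r i] (mapGr g W) i := fun i => (g i).submoduleMap (W i)
  let gq : ∀ i, (V i ⧸ W i) ≃ₗ[Γ.Fv k p r i] (V' i ⧸ (mapGr g W) i) := fun i =>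
    Submodule.Quotient.equiv (W i) _ (g i) rfl
  have hs : Intertwines gs (restr x W hW) (restr x' (mapGr g W) hW') := by
    intro κ c v
    exact Subtype.ext (h κ c v)
  have hq : Intertwines gq (quot x W hW) (quot x' (mapGr g W) hW') := by
    intro κ c v
    obtain ⟨v, rfl⟩ := Submodule.mkQ_surjective _ v
    exact congrArg Submodule.Quotient.mk (h κ c v)
  change ((ε ^ (-(Γ.m (dim k p r fun i => V i ⧸ W i) (dim k p r fun i => W i) : ℤ)) : Rˣ) : R) *
      (ev f (quot x W hW) * ev f' (restr x W hW)) =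
    ((ε ^ (-(Γ.m (dim k p r fun i => V' i ⧸ mapGr g W i) (dim k p r fun i => mapGr g W i) : ℤ)) :
      Rˣ) : R) * (ev f (quot x' _ hW') * ev f' (restr x' _ hW'))
  rw [dim_eq gs, dim_eq gq, ev_congr f hq, ev_congr f' hs]

theorem mulAt_add_left (ε : Rˣ) (f₁ f₂ f' : Hall Γ k p r R) [∀ i, Finite (V i)] (x : Γ.E k p r V) :
    mulAt ε (f₁ + f₂) f' x = mulAt ε f₁ f' x + mulAt ε f₂ f' x := by
  unfold mulAt
  rw [← finsum_add_distrib (Set.toFinite _) (Set.toFinite _)]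
  exact finsum_congr fun W => by rw [ev_add, add_mul, mul_add]

theorem mulAt_add_right (ε : Rˣ) (f f₁ f₂ : Hall Γ k p r R) [∀ i, Finite (V i)] (x : Γ.E k p r V) :
    mulAt ε f (f₁ + f₂) x = mulAt ε f f₁ x + mulAt ε f f₂ x := by
  unfold mulAt
  rw [← finsum_add_distrib (Set.toFinite _) (Set.toFinite _)]
  exact finsum_congr fun W => by rw [ev_add, mul_add, mul_add]

theorem mulAt_smul_left (ε : Rˣ) (a : R) (f f' : Hall Γ k p r R) [∀ i, Finite (V i)]
    (x : Γ.E k p r V) : mulAt ε (a • f) f' x = a * mulAt ε f f' x := by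
  unfold mulAt
  rw [mul_finsum' _ _ (Set.toFinite _)]
  exact finsum_congr fun W => by rw [ev_smul, mul_assoc, mul_left_comm]

theorem mulAt_smul_right (ε : Rˣ) (a : R) (f f' : Hall Γ k p r R) [∀ i, Finite (V i)]
    (x : Γ.E k p r V) : mulAt ε f (a • f') x = a * mulAt ε f f' x := by
  unfold mulAt
  rw [mul_finsum' _ _ (Set.toFinite _)]
  exact finsum_congr fun W => by rw [ev_smul, mul_left_comm (ev f _), mul_left_comm]

theorem exists_of_mulAt_ne_zero {ε : Rˣ} {f f' : Hall Γ k p r R} [∀ i, Finite (V i)]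
    {x : Γ.E k p r V} (hx : mulAt ε f f' x ≠ 0) :
    dim k p r V ∈ Set.image2 (· + ·) {ν | ∃ x, f.1 ν x ≠ 0} {ν | ∃ x, f'.1 ν x ≠ 0} := by
  by_contra hc
  refine hx ((finsum_congr fun W => ?_).trans finsum_zero)
  by_contra h
  have h := right_ne_zero_of_mul h
  exact hc ⟨_, ⟨_, left_ne_zero_of_mul h⟩, _, ⟨_, right_ne_zero_of_mul h⟩, dim_quot_add_dim W.1⟩

/-- The twisted product of two elements of the Hall algebra. -/
noncomputable def mulFun [NeZero r] (ε : Rˣ) (f f' : Hall Γ k p r R) : Hall Γ k p r R :=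
  ⟨fun _ x => mulAt ε f f' x, fun _ _ _ _ h => mulAt_congr ε f f' h, by
    refine (f.2.2.image2 (· + ·) f'.2.2).subset ?_
    rintro ν ⟨x, hx⟩
    have h := exists_of_mulAt_ne_zero hx
    rwa [dim_std] at h⟩

variable (Γ k p r) in
/-- The twisted multiplication `∘` on the Hall algebra, for a choice `ε` of square root of `q`. -/
noncomputable def mul [NeZero r] (ε : Rˣ) : Hall Γ k p r R →ₗ[R] Hall Γ k p r R →ₗ[R] Hall Γ k p r R :=
  LinearMap.mk₂ R (mulFun ε)
    (fun f₁ f₂ f' => Subtype.ext <| funext fun _ => funext fun x => mulAt_add_left ε f₁ f₂ f' x)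
    (fun a f f' => Subtype.ext <| funext fun _ => funext fun x => mulAt_smul_left ε a f f' x)
    (fun f f₁ f₂ => Subtype.ext <| funext fun _ => funext fun x => mulAt_add_right ε f f₁ f₂ x)
    (fun a f f' => Subtype.ext <| funext fun _ => funext fun x => mulAt_smul_right ε a f f' x)

end Mul

variable (Γ k p r R) in
open Classical in
/-- The unit of the Hall algebra: the function `1` on the point `E_0`. -/
noncomputable def one : Hall Γ k p r R :=
  ⟨fun ν _ => if ν = 0 then 1 else 0, fun _ _ _ _ _ => rfl, by
    refine (Set.finite_singleton (0 : Γ.I → ℕ)).subset ?_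
    rintro ν ⟨x, hx⟩
    by_contra h
    exact hx (if_neg h)⟩

/-! ### Flags and the composition algebra -/

open Classical in
/-- `F` is an `x`-stable flag `V = F_0 ⊇ F_1 ⊇ ⋯ ⊇ F_n = 0` of type `(i, c)`: the dimension of
`F_{a-1} / F_a` is `c_a i_a`. -/
def IsFlag (x : Γ.E k p r V) {n : ℕ} (i : Fin n → Γ.I) (c : Fin n → ℕ)
    (F : Fin (n + 1) → Γ.GrSub k p r V) : Prop :=
  F 0 = ⊤ ∧ F (Fin.last n) = ⊥ ∧ (∀ a, Stable x (F a)) ∧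
    ∀ a : Fin n, F a.succ ≤ F a.castSucc ∧
      ∀ j, dim k p r (fun j => F a.castSucc j) j =
        dim k p r (fun j => F a.succ j) j + if j = i a then c a else 0

theorem IsFlag.map {x : Γ.E k p r V} {x' : Γ.E k p r V'} {g} (h : Intertwines g x x') {n : ℕ}
    {i : Fin n → Γ.I} {c : Fin n → ℕ} {F : Fin (n + 1) → Γ.GrSub k p r V} (hF : IsFlag x i c F) :
    IsFlag x' i c (fun a => mapGr g (F a)) := by
  have hd : ∀ W : Γ.GrSub k p r V, dim k p r (fun j => mapGr g W j) = dim k p r (fun j => W j) :=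
    fun W => (dim_eq fun i => (g i).submoduleMap (W i)).symm
  refine ⟨?_, ?_, fun a => (h.stable_iff _).1 (hF.2.2.1 a), fun a => ⟨fun j => ?_, fun j => ?_⟩⟩
  · funext j
    change mapGr g (F 0) j = ⊤
    rw [hF.1, mapGr_apply]
    exact (Submodule.map_top _).trans (LinearEquiv.range (g j))
  · funext j
    change mapGr g (F (Fin.last n)) j = ⊥
    rw [hF.2.1, mapGr_apply]
    exact Submodule.map_bot _
  · exact Submodule.map_mono ((hF.2.2.2 a).1 j)
  · rw [hd, hd]
    exact (hF.2.2.2 a).2 j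

/-- The number of `x`-stable flags of type `(i, c)`. -/
noncomputable def flagCount (x : Γ.E k p r V) {n : ℕ} (i : Fin n → Γ.I) (c : Fin n → ℕ) : ℕ :=
  Nat.card {F : Fin (n + 1) → Γ.GrSub k p r V // IsFlag x i c F}

theorem flagCount_congr {x : Γ.E k p r V} {x' : Γ.E k p r V'} {g} (h : Intertwines g x x') {n : ℕ}
    (i : Fin n → Γ.I) (c : Fin n → ℕ) : flagCount x i c = flagCount x' i c := by
  refine Nat.card_congr ((Equiv.piCongrRight fun _ => mapGr g).subtypeEquiv fun F =>
    ⟨fun hF => hF.map h, fun hF => ?_⟩)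
  have := hF.map h.symm
  convert this using 1
  funext a j
  ext v
  simp [mapGr_apply]

open Classical in
theorem IsFlag.dim_eq {x : Γ.E k p r V} {n : ℕ} {i : Fin n → Γ.I} {c : Fin n → ℕ}
    {F : Fin (n + 1) → Γ.GrSub k p r V} (hF : IsFlag x i c F) :
    dim k p r V = fun j => ∑ a, if j = i a then c a else 0 := by
  funext j
  have h1 := Fin.sum_univ_succ (fun a => dim k p r (fun j => F a j) j)
  have h2 := Fin.sum_univ_castSucc (fun a => dim k p r (fun j => F a j) j)
  rw [Finset.sum_congr rfl fun a _ => (hF.2.2.2 a).2 j, Finset.sum_add_distrib] at h2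
  have h3 : dim k p r (fun j => F 0 j) j = dim k p r V j := by
    rw [hF.1]
    exact finrank_top _ _
  have h4 : dim k p r (fun j => F (Fin.last n) j) j = 0 := by
    rw [hF.2.1]
    exact finrank_bot _ _
  omega

variable (k p r R) in
/-- The function `𝟏_{(i, c)}`, whose value at `x` is the number of `x`-stable flags of type `(i, c)`. -/
noncomputable def flagFun {n : ℕ} (i : Fin n → Γ.I) (c : Fin n → ℕ) : Hall Γ k p r R :=
  ⟨fun ν x => (flagCount x i c : R), fun ν x x' g h => congrArg Nat.cast (flagCount_congr h i c), by
    classical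
    refine (Set.finite_singleton (fun j => ∑ a, if j = i a then c a else 0)).subset ?_
    rintro ν ⟨x, hx⟩
    have h : flagCount x i c ≠ 0 := fun h => hx (by simp only [h, Nat.cast_zero])
    obtain ⟨⟨F, hF⟩⟩ := (Nat.card_ne_zero.1 h).1
    exact (dim_std ν).symm.trans hF.dim_eq⟩

variable (k p r) in
/-- The normalized function `ϑ_{(i, c)} = ε ^ (-N(i, c)) 𝟏_{(i, c)}`. -/
noncomputable def theta [Fintype J] [Fintype H] (ε : Rˣ) {n : ℕ} (i : Fin n → Γ.I)
    (c : Fin n → ℕ) : Hall Γ k p r R :=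
  ((ε ^ (-(Γ.N i c : ℤ)) : Rˣ) : R) • flagFun k p r R i c

variable (Γ k p r R) in
/-- The composition algebra `ℱ` over `R`: the `R`-submodule of `R ⊗ ℋ` spanned by the functions
`𝟏_{(i, c)}`. -/
noncomputable def compAlg : Submodule R (Hall Γ k p r R) :=
  Submodule.span R {f | ∃ (n : ℕ) (i : Fin n → Γ.I) (c : Fin n → ℕ), f = flagFun k p r R i c}

/-! ### Restriction of scalars from `𝔽_{q ^ ℓ}` to `𝔽_q` -/

section Restriction

variable {ℓ : ℕ}

/-- `𝔽_{q ^ (ℓ d_i)}` is an algebra over `𝔽_{q ^ d_i}` by inclusion. -/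
noncomputable instance algRes (i : Γ.I) : Algebra (Γ.Fv k p r i) (Γ.Fv k p (r * ℓ) i) :=
  (Subfield.inclusion (GF_mono k p (Nat.mul_dvd_mul_right (Nat.dvd_mul_right r ℓ) _)) :
    Γ.Fv k p r i →+* Γ.Fv k p (r * ℓ) i).toAlgebra

variable (k p r ℓ) in
/-- The inclusion of `𝔽_{q ^ e}` into `𝔽_{q ^ (ℓ e)}`. -/
noncomputable def inclE (κ : Γ.K) : Γ.Fe k p r κ →+* Γ.Fe k p (r * ℓ) κ :=
  Subfield.inclusion (GF_mono k p (Nat.mul_dvd_mul_right (Nat.dvd_mul_right r ℓ) _))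

variable {U : Γ.I → Type u} [∀ i, AddCommGroup (U i)] [∀ i, Module (Γ.Fv k p (r * ℓ) i) (U i)]
  [∀ i, Module (Γ.Fv k p r i) (U i)] [∀ i, IsScalarTower (Γ.Fv k p r i) (Γ.Fv k p (r * ℓ) i) (U i)]

/-- The map `ι_ℓ : E_U → E_{R_ℓ(U)}`, where `R_ℓ(U)` is `U` with scalars restricted from the fields
`𝔽_{q ^ (ℓ d_i)}` to `𝔽_{q ^ d_i}`. -/
noncomputable def iota (x : Γ.E k p (r * ℓ) U) : Γ.E k p r U := fun κ =>
  mkHom κ (fun c v => x κ (inclE k p r ℓ κ c ⊗ₜ v))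
    (fun c c' v => by rw [map_add, TensorProduct.add_tmul, map_add])
    (fun c v v' => by rw [TensorProduct.tmul_add, map_add])
    (fun a c v => by
      rw [← algebraMap_smul (Γ.Fv k p (r * ℓ) (Γ.src κ)) a v, ← TensorProduct.smul_tmul]
      rfl)
    (fun a c v => by
      rw [← algebraMap_smul (Γ.Fv k p (r * ℓ) (Γ.tgt κ)) a (x κ _), ← map_smul,
        TensorProduct.smul_tmul']
      rfl)

@[simp] theorem iota_tmul (x : Γ.E k p (r * ℓ) U) (κ : Γ.K) (c : Γ.Fe k p r κ) (v : U (Γ.src κ)) :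
    (iota x : Γ.E k p r U) κ (c ⊗ₜ v) = x κ (inclE k p r ℓ κ c ⊗ₜ v) := rfl

variable [Finite J] [NeZero r] [NeZero ℓ]

theorem dim_res (μ : Γ.I → ℕ) (i : Γ.I) :
    dim k p r (Γ.Std k p (r * ℓ) μ) i =
      μ i * Module.finrank (Γ.Fv k p r i) (Γ.Fv k p (r * ℓ) i) := by
  simp [dim, Std, Module.finrank_pi_fintype]

variable (Γ k p r ℓ R) in
/-- The map `Q : ℋ → ℋ^♯`, `Q(f) = ι_ℓ^*(f)`: the value of `Q f` at `x ∈ E_U` is the value of `f` at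
`ι_ℓ(x) ∈ E_{R_ℓ(U)}`. -/
noncomputable def frobQ : Hall Γ k p r R →ₗ[R] Hall Γ k p (r * ℓ) R where
  toFun f := ⟨fun _ x => ev f (iota x : Γ.E k p r _), fun ν x x' g h => by
      refine ev_congr f (g := fun i => (g i).restrictScalars (Γ.Fv k p r i)) ?_
      intro κ c v
      exact h κ (inclE k p r ℓ κ c) v, by
    refine (f.2.2.preimage (f := fun μ => dim k p r (Γ.Std k p (r * ℓ) μ)) ?_).subset ?_
    · intro μ _ μ' _ h
      funext i
      have h' := congrFun h i
      simp only [dim_res] at h'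
      exact Nat.eq_of_mul_eq_mul_right Module.finrank_pos h'
    · rintro μ ⟨x, hx⟩
      exact ⟨_, hx⟩⟩
  map_add' _ _ := rfl
  map_smul' _ _ := rfl

end Restriction

end Points

end AutQuiver

/-! ## Coefficients -/

/-- The ring `𝒜 = ℤ[ε, ε⁻¹]`. -/
abbrev coeffRing (ε : ℝˣ) : Type := Algebra.adjoin ℤ {(ε : ℝ), ((ε⁻¹ : ℝˣ) : ℝ)}

/-- `ε` as a unit of `ℤ[ε, ε⁻¹]`. -/
def coeffUnit (ε : ℝˣ) : (coeffRing ε)ˣ where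
  val := ⟨ε, Algebra.subset_adjoin (by simp)⟩
  inv := ⟨(ε⁻¹ : ℝˣ), Algebra.subset_adjoin (by simp)⟩
  val_inv := Subtype.ext ε.mul_inv
  inv_val := Subtype.ext ε.inv_mul

/-- The ring `𝒜_ℓ = ℤ[ε, ε⁻¹] / (Φ_{2ℓ}(ε))`. -/
abbrev cycloRing (ε : ℝˣ) (ℓ : ℕ) : Type :=
  coeffRing ε ⧸ Ideal.span
    {Polynomial.aeval (coeffUnit ε : coeffRing ε) (Polynomial.cyclotomic (2 * ℓ) ℤ)}

/-- The image of `ε` in `𝒜_ℓ`. -/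
def cycloUnit (ε : ℝˣ) (ℓ : ℕ) : (cycloRing ε ℓ)ˣ :=
  Units.map (Ideal.Quotient.mk _ : coeffRing ε →+* cycloRing ε ℓ).toMonoidHom (coeffUnit ε)

/-! ## Cyclotomic polynomials and the coefficient ring -/

namespace Polynomial

/-! Everything rests on counting flags modulo `Φ_ℓ(q)`. Scalars from `𝔽_{q^ℓ}ˣ` commute with
`ι_ℓ(x)`, so this group acts on the `ι_ℓ(x)`-stable flags over the small fields. The scalars
preserving a given flag form a subring of `𝔽_{q^ℓ}` that contains `𝔽_q`, hence with `q^m` elements;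
its nonzero elements are the stabilizer, so the orbit has `(q^ℓ - 1)/(q^m - 1)` elements. If the
flag is not fixed, then `m < ℓ` and `Φ_ℓ(q)` divides this number (`cyclotomic_dvd_card_orbit`). But
`Φ_ℓ(q) = Φ_ℓ(ε²)` is a multiple of `Φ_{2ℓ}(ε)`, so it vanishes in `𝒜_ℓ`
(`cycloRing_cyclotomic_eval`), and only fixed flags count there.

A fixed flag consists of subspaces stable under `𝔽_{q^{d_i}}` and `𝔽_{q^ℓ}`. These two fields
generate `𝔽_{q^{ℓ d_i}}` because `ℓ` is prime to `d_i`; the same argument for `e_κ` turns stability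
under `ι_ℓ(x)` into stability under `x` (`GF_induction_of_coprime`, `stable_iota_resGr_iff`). So
fixed flags of type `(i, c)` are exactly the `x`-stable flags of type `(i, c/ℓ)` over the large
fields, and there are none unless `ℓ` divides every `c_k`. This computes `Q` on flag functions
(`frobQ_flagFun_mul`, `frobQ_flagFun_eq_zero`).

For multiplicativity, cutting a flag at a middle term shows that a product of flag functions is a
power of `η` times the flag function of the concatenated type (`mul_flagFun`). The exponents `m` and
`N` are quadratic, so replacing `c` by `c/ℓ` divides them by `ℓ²`. The normalizations match because
`ε^ℓ = -1` in `𝒜_ℓ`, whence `ε^(ℓ²) = (-1)^ℓ = ε_ℓ`. Bilinearity extends the identity to the span of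
the flag functions. -/

theorem cyclotomic_two_mul_dvd_expand (n : ℕ) :
    cyclotomic (2 * n) ℤ ∣ expand ℤ 2 (cyclotomic n ℤ) := by
  by_cases h : 2 ∣ n
  · rw [cyclotomic_expand_eq_cyclotomic Nat.prime_two h, mul_comm]
  · rw [cyclotomic_expand_eq_cyclotomic_mul Nat.prime_two h, mul_comm n]
    exact dvd_mul_right _ _

/-- Cancel `X ^ n - 1` from `(X ^ n - 1) Φ_{2n} ∣ X ^ (2n) - 1 = (X ^ n - 1)(X ^ n + 1)`. -/
theorem cyclotomic_two_mul_dvd_X_pow_add_one {n : ℕ} (hn : n ≠ 0) :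
    cyclotomic (2 * n) ℤ ∣ X ^ n + 1 := by
  have h := X_pow_sub_one_mul_cyclotomic_dvd_X_pow_sub_one_of_dvd ℤ (d := n) (n := 2 * n)
    (Nat.mem_properDivisors.2 ⟨Nat.dvd_mul_left n 2, by omega⟩)
  have hX : (X ^ n - 1 : ℤ[X]) ≠ 0 := X_pow_sub_C_ne_zero (Nat.pos_of_ne_zero hn) 1
  refine (mul_dvd_mul_iff_left hX).1 (h.trans (dvd_of_eq ?_))
  ring

/-- Applied with `c` the size of an orbit. The polynomial divisibility `(X ^ m - 1) Φ_n ∣ X ^ n - 1`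
needs `m ∣ n`, which the numerical hypothesis already forces through `gcd (q ^ m - 1) (q ^ n - 1) =
q ^ (gcd m n) - 1`. -/
theorem cyclotomic_eval_dvd_of_mul_eq {q m n c : ℕ} (hq : 1 < q) (hm : m ≠ 0) (hmn : m < n)
    (h : c * (q ^ m - 1) = q ^ n - 1) : (cyclotomic n ℤ).eval (q : ℤ) ∣ c := by
  have hdvd : m ∣ n := by
    have h1 : (q ^ m - 1).gcd (q ^ n - 1) = q ^ m - 1 :=
      Nat.gcd_eq_left (Dvd.intro_left c h)
    rw [Nat.pow_sub_one_gcd_pow_sub_one] at h1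
    have h2 : q ^ m.gcd n = q ^ m := by
      have := Nat.one_le_pow m q (by omega)
      have := Nat.one_le_pow (m.gcd n) q (by omega)
      omega
    exact Nat.gcd_eq_left_iff_dvd.1 (Nat.pow_right_injective hq h2)
  have h1 : ((X ^ m - 1) * cyclotomic n ℤ).eval (q : ℤ) ∣ (X ^ n - 1 : ℤ[X]).eval (q : ℤ) :=
    eval_dvd (X_pow_sub_one_mul_cyclotomic_dvd_X_pow_sub_one_of_dvd ℤ
      (Nat.mem_properDivisors.2 ⟨hdvd, hmn⟩))
  have hc (a : ℕ) : ((q ^ a - 1 : ℕ) : ℤ) = (q : ℤ) ^ a - 1 := by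
    rw [Nat.cast_sub (Nat.one_le_pow a q (by omega))]
    simp
  have h0 : (q : ℤ) ^ m - 1 ≠ 0 := by
    rw [← hc]
    have := Nat.one_lt_pow hm hq
    exact_mod_cast (by omega : q ^ m - 1 ≠ 0)
  have h2 : (c : ℤ) * ((q : ℤ) ^ m - 1) = (q : ℤ) ^ n - 1 := by
    rw [← hc, ← hc, ← h]
    push_cast
    rfl
  simp only [eval_mul, eval_sub, eval_pow, eval_X, eval_one, ← h2] at h1
  rw [mul_comm (c : ℤ)] at h1
  exact (mul_dvd_mul_iff_left h0).1 h1

end Polynomial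

/-! ### Relations in the ring `𝒜_ℓ`. -/

section Coefficients

open Polynomial

theorem aeval_cycloUnit_cyclotomic (ε : ℝˣ) (ℓ : ℕ) :
    aeval (cycloUnit ε ℓ : cycloRing ε ℓ) (cyclotomic (2 * ℓ) ℤ) = 0 := by
  have h : (Ideal.Quotient.mk (Ideal.span {aeval (coeffUnit ε : coeffRing ε)
      (cyclotomic (2 * ℓ) ℤ)})).toIntAlgHom
      (aeval (coeffUnit ε : coeffRing ε) (cyclotomic (2 * ℓ) ℤ)) = 0 :=
    Ideal.Quotient.eq_zero_iff_mem.2 (Ideal.mem_span_singleton_self _)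
  rwa [← aeval_algHom_apply] at h

theorem aeval_cycloUnit_of_dvd (ε : ℝˣ) (ℓ : ℕ) {P : ℤ[X]} (h : cyclotomic (2 * ℓ) ℤ ∣ P) :
    aeval (cycloUnit ε ℓ : cycloRing ε ℓ) P = 0 := by
  obtain ⟨c, rfl⟩ := h
  rw [map_mul, aeval_cycloUnit_cyclotomic, zero_mul]

theorem cycloUnit_pow (ε : ℝˣ) {ℓ : ℕ} (hℓ : ℓ ≠ 0) : cycloUnit ε ℓ ^ ℓ = -1 := by
  have h := aeval_cycloUnit_of_dvd ε ℓ (cyclotomic_two_mul_dvd_X_pow_add_one hℓ)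
  simp only [map_add, map_pow, aeval_X, map_one] at h
  exact Units.ext (by push_cast; exact eq_neg_of_add_eq_zero_left h)

theorem cycloUnit_sq {ε : ℝˣ} (ℓ : ℕ) {q : ℕ} (h : (ε : ℝ) ^ 2 = q) :
    (cycloUnit ε ℓ : cycloRing ε ℓ) ^ 2 = q := by
  have h' : (coeffUnit ε : coeffRing ε) ^ 2 = q := Subtype.ext (by push_cast; exact h)
  have := congrArg (Ideal.Quotient.mk (Ideal.span {aeval (coeffUnit ε : coeffRing ε)
      (cyclotomic (2 * ℓ) ℤ)})) h'
  rwa [map_pow, map_natCast] at this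

/-- Evaluate `Φ_{2ℓ}(X) ∣ Φ_ℓ(X²)` at `ε`, using `ε² = q`. -/
theorem cycloRing_cyclotomic_eval {ε : ℝˣ} (ℓ : ℕ) {q : ℕ} (h : (ε : ℝ) ^ 2 = q) :
    (((cyclotomic ℓ ℤ).eval (q : ℤ) : ℤ) : cycloRing ε ℓ) = 0 := by
  have h1 := aeval_cycloUnit_of_dvd ε ℓ (cyclotomic_two_mul_dvd_expand ℓ)
  rw [expand_aeval, cycloUnit_sq ℓ h] at h1
  rw [← h1, ← Int.cast_natCast (R := cycloRing ε ℓ) q, ← eq_intCast (algebraMap ℤ (cycloRing ε ℓ)),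
    ← eq_intCast (algebraMap ℤ (cycloRing ε ℓ)), aeval_algebraMap_apply, coe_aeval_eq_eval]

/-- Both sides are `(-1) ^ ℓ`. This explains the sign in `ε_ℓ = (-1) ^ (ℓ + 1) ε ^ ℓ`: it makes
`ε_ℓ` equal to `ε ^ (ℓ * ℓ)`, the power produced by quadratic exponents. -/
theorem Units.pow_mul_self_of_pow_eq_neg_one {R : Type*} [CommRing R] {a : Rˣ} {ℓ : ℕ}
    (h : a ^ ℓ = -1) : a ^ (ℓ * ℓ) = (-1) ^ (ℓ + 1) * a ^ ℓ := by
  rw [pow_mul, h, pow_succ, mul_assoc, neg_mul_neg, one_mul, mul_one]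

end Coefficients

/-! ## Orbit counting -/

namespace MulAction

theorem dvd_card_sub_card_fixedPoints {G α : Type*} [Group G] [MulAction G α] [Finite α] (D : ℤ)
    (h : ∀ a : α, a ∉ fixedPoints G α → D ∣ Nat.card (orbit G a)) :
    D ∣ (Nat.card α : ℤ) - Nat.card (fixedPoints G α) := by
  classical
  let Ω := Quotient (orbitRel G α)
  have : Fintype Ω := Fintype.ofFinite _
  have h1 : Nat.card α = ∑ ω : Ω, Nat.card (orbit G ω.out) := by
    rw [Nat.card_congr (selfEquivSigmaOrbits G α), Nat.card_sigma]
  -- Fixed points are counted by orbits: the orbit of a fixed point is a singleton, so its chosen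
  -- representative is that point.
  have h2 : Nat.card (fixedPoints G α) =
      ∑ ω : Ω, if ω.out ∈ fixedPoints G α then 1 else 0 := by
    rw [Finset.sum_boole, Nat.cast_id, ← Fintype.card_subtype, ← Nat.card_eq_fintype_card]
    have key (a : α) (ha : a ∈ fixedPoints G α) : (Quotient.mk (orbitRel G α) a).out = a := by
      obtain ⟨g, hg⟩ := Quotient.exact (Quotient.out_eq (Quotient.mk (orbitRel G α) a))
      exact hg.symm.trans (ha g)
    refine Nat.card_congr ⟨fun a => ⟨Quotient.mk _ a.1, ?_⟩, fun ω => ⟨_, ω.2⟩, fun a => ?_,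
      fun ω => ?_⟩
    · rw [key _ a.2]
      exact a.2
    · exact Subtype.ext (key _ a.2)
    · exact Subtype.ext (Quotient.out_eq ω.1)
  rw [h1, h2]
  push_cast
  rw [← Finset.sum_sub_distrib]
  refine Finset.dvd_sum fun ω _ => ?_
  split_ifs with hω
  · have : Nat.card (orbit G ω.out) = 1 := by
      rw [Set.eq_singleton_iff_unique_mem.2 ⟨mem_orbit_self ω.out, ?_⟩]
      · simp
      · rintro _ ⟨g, rfl⟩
        exact hω g
    simp [this]
  · simpa using h _ hω

end MulAction

/-! ## Finite subfields -/

section Fields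

variable {k : Type u} [Field k]

/-- Only the `K`-vector space structure of `B` is needed, so `B` need not be known to be a field. -/
theorem Subfield.exists_card_eq_pow (K : Subfield k) (B : Subring k) [Finite B]
    (h : K.toSubring ≤ B) : ∃ x, Nat.card B = Nat.card K ^ x := by
  let _ : Module K B := Module.compHom B (Subring.inclusion h)
  exact ⟨_, Module.natCard_eq_pow_finrank (K := K) (V := B)⟩

variable [IsAlgClosed k] {p : ℕ} [Fact p.Prime] [CharP k p]

theorem card_GF (n : ℕ) [NeZero n] : Nat.card (GF k p n) = p ^ n := by
  have h1 : 1 < p ^ n := Nat.one_lt_pow (NeZero.ne n) (Fact.out : p.Prime).one_lt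
  have hs : (Polynomial.X ^ p ^ n - Polynomial.X : Polynomial k).Separable :=
    galois_poly_separable p _ (dvd_pow_self p (NeZero.ne n))
  have h := Polynomial.card_rootSet_eq_natDegree (K := k) hs (IsAlgClosed.splits _)
  rw [FiniteField.X_pow_card_sub_X_natDegree_eq k h1, ← Nat.card_eq_fintype_card] at h
  rw [← h]
  refine Nat.card_congr (Equiv.subtypeEquivRight fun x => ?_)
  rw [Polynomial.mem_rootSet, mem_GF]
  simp [sub_eq_zero, FiniteField.X_pow_card_sub_X_ne_zero k h1]

/-- `𝔽_{q ^ (ℓ d)}` is additively generated by the products of elements of `𝔽_{q ^ d}` and of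
`𝔽_{q ^ ℓ}` if `ℓ` and `d` are coprime. -/
theorem GF_induction_of_coprime {r ℓ d : ℕ} [NeZero r] [NeZero ℓ] [NeZero d]
    (hc : Nat.Coprime ℓ d) {P : k → Prop}
    (hmul : ∀ a ∈ GF k p (r * d), ∀ b ∈ GF k p (r * ℓ), P (a * b))
    (hadd : ∀ x y, x ∈ GF k p (r * ℓ * d) → y ∈ GF k p (r * ℓ * d) → P x → P y → P (x + y))
    {x : k} (hx : x ∈ GF k p (r * ℓ * d)) : P x := by
  have hd : GF k p (r * d) ≤ GF k p (r * ℓ * d) := GF_mono k p ⟨ℓ, by ring⟩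
  have hl : GF k p (r * ℓ) ≤ GF k p (r * ℓ * d) := GF_mono k p ⟨d, by ring⟩
  let S : Subalgebra ℤ k := subalgebraOfSubring (GF k p (r * d)).toSubring
  let T : Subalgebra ℤ k := subalgebraOfSubring (GF k p (r * ℓ)).toSubring
  let L : Subalgebra ℤ k := subalgebraOfSubring (GF k p (r * ℓ * d)).toSubring
  have hle : S ⊔ T ≤ L := sup_le hd hl
  have hmem : x ∈ S ⊔ T := by
    have hfin : Finite (GF k p (r * ℓ * d)) := inferInstance
    have : Finite (S ⊔ T).toSubring :=
      Finite.of_injective (Subring.inclusion (T := (GF k p (r * ℓ * d)).toSubring) hle)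
        (Subring.inclusion_injective _)
    obtain ⟨a, ha⟩ := Subfield.exists_card_eq_pow (GF k p (r * d)) (S ⊔ T).toSubring
      (le_sup_left (a := S) (b := T))
    obtain ⟨b, hb⟩ := Subfield.exists_card_eq_pow (GF k p (r * ℓ)) (S ⊔ T).toSubring
      (le_sup_right (a := S) (b := T))
    rw [card_GF, ← pow_mul] at ha hb
    have hp : 1 < p := (Fact.out : p.Prime).one_lt
    have hab := Nat.pow_right_injective hp (ha.symm.trans hb)
    simp only [mul_assoc] at hab
    have hab' := Nat.eq_of_mul_eq_mul_left (NeZero.pos r) hab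
    have hla : ℓ ∣ a := hc.dvd_of_dvd_mul_left (Dvd.intro b hab'.symm)
    have hpos : a ≠ 0 := by
      rintro rfl
      rw [mul_zero, pow_zero] at ha
      have := (Nat.card_eq_one_iff_unique.1 ha).1
      exact zero_ne_one (this.elim 0 1)
    have hcard : Nat.card (GF k p (r * ℓ * d)) ≤ Nat.card (S ⊔ T).toSubring := by
      rw [card_GF, ha]
      refine Nat.pow_le_pow_right hp.le ?_
      have := Nat.le_of_dvd (Nat.pos_of_ne_zero hpos) hla
      calc r * ℓ * d = r * d * ℓ := by ring
        _ ≤ r * d * a := Nat.mul_le_mul_left _ this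
    have hset : ((S ⊔ T : Subalgebra ℤ k) : Set k) = (GF k p (r * ℓ * d) : Set k) :=
      Set.eq_of_subset_of_ncard_le (s := ((S ⊔ T : Subalgebra ℤ k) : Set k))
        (t := (GF k p (r * ℓ * d) : Set k)) hle hcard
        (Set.toFinite (GF k p (r * ℓ * d) : Set k))
    exact hset.ge hx
  -- In a commutative ring the join of two subalgebras is the span of the products `a * b`; this is
  -- what permits an induction over sums of products.
  have hmem' : x ∈ Subalgebra.toSubmodule S * Subalgebra.toSubmodule T := by
    rw [Subalgebra.mul_toSubmodule]
    exact hmem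
  have : x ∈ GF k p (r * ℓ * d) ∧ P x := by
    refine Submodule.mul_induction_on hmem' (fun a ha b hb => ⟨?_, hmul a ha b hb⟩)
      (fun y z hy hz => ⟨add_mem hy.1 hz.1, hadd y z hy.1 hz.1 hy.2 hz.2⟩)
    exact mul_mem (hd ha) (hl hb)
  exact this.2

end Fields

namespace AutQuiver

/-! ### Scalars from `𝔽_{q ^ ℓ}` and stable flags. -/

section Scalars

variable {J : Type v} {H : Type w} {Γ : AutQuiver J H}
variable {k : Type u} [Field k] {p : ℕ} [Fact p.Prime] [CharP k p] {r ℓ : ℕ}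

/-- An element of `𝔽_{q ^ d_i}`. -/
def mkFv (i : Γ.I) (x : k) (hx : x ∈ GF k p (r * Γ.d i)) : Γ.Fv k p r i := ⟨x, hx⟩

/-- An element of `𝔽_{q ^ e_κ}`. -/
def mkFe (κ : Γ.K) (x : k) (hx : x ∈ GF k p (r * Γ.e κ)) : Γ.Fe k p r κ := ⟨x, hx⟩

/-- The inclusion of `𝔽_q` into `𝔽_{q ^ d_i}`. -/
noncomputable def scalV (i : Γ.I) : GF k p r →+* Γ.Fv k p r i :=
  Subfield.inclusion (GF_mono k p (Nat.dvd_mul_right _ _))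

/-- The inclusion of `𝔽_q` into `𝔽_{q ^ e_κ}`. -/
noncomputable def scalE (κ : Γ.K) : GF k p r →+* Γ.Fe k p r κ :=
  Subfield.inclusion (GF_mono k p (Nat.dvd_mul_right _ _))

theorem E_tmul_scalE_mul {V : Γ.I → Type u} [∀ i, AddCommGroup (V i)]
    [∀ i, Module (Γ.Fv k p r i) (V i)] (x : Γ.E k p r V) (a : GF k p r) (κ : Γ.K)
    (c : Γ.Fe k p r κ) (v : V (Γ.src κ)) :
    x κ ((scalE κ a * c) ⊗ₜ v) = scalV (Γ.tgt κ) a • x κ (c ⊗ₜ v) := by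
  rw [← map_smul, TensorProduct.smul_tmul']
  rfl

/-- A scalar of `𝔽_q` lies in all the fields involved, so it can be moved across the tensor product
and out of `x κ`. Used with `q ^ ℓ` in place of `q`, this lets `𝔽_{q ^ ℓ}ˣ` act on flags. -/
theorem E_tmul_scalV_smul {V : Γ.I → Type u} [∀ i, AddCommGroup (V i)]
    [∀ i, Module (Γ.Fv k p r i) (V i)] (x : Γ.E k p r V) (a : GF k p r) (κ : Γ.K)
    (c : Γ.Fe k p r κ) (v : V (Γ.src κ)) :
    x κ (c ⊗ₜ (scalV (Γ.src κ) a • v)) = scalV (Γ.tgt κ) a • x κ (c ⊗ₜ v) := by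
  rw [← E_tmul_scalE_mul, ← TensorProduct.smul_tmul]
  rfl

instance neZero_e [Finite H] (κ : Γ.K) : NeZero (Γ.e κ) :=
  ⟨(Function.minimalPeriod_pos_of_mem_periodicPts
    (Function.Injective.mem_periodicPts Γ.aH.injective _)).ne'⟩

theorem finrank_Fv [IsAlgClosed k] [Finite J] [NeZero r] [NeZero ℓ] (i : Γ.I) :
    Module.finrank (Γ.Fv k p r i) (Γ.Fv k p (r * ℓ) i) = ℓ := by
  have h := Module.natCard_eq_pow_finrank (K := Γ.Fv k p r i) (V := Γ.Fv k p (r * ℓ) i)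
  have h1 : Nat.card (Γ.Fv k p r i) = p ^ (r * Γ.d i) := card_GF (k := k) _
  have h2 : Nat.card (Γ.Fv k p (r * ℓ) i) = p ^ (r * ℓ * Γ.d i) := card_GF (k := k) _
  rw [h1, h2, ← pow_mul] at h
  have h3 := Nat.pow_right_injective (Fact.out : p.Prime).one_lt h
  have h4 : r * Γ.d i * ℓ = r * Γ.d i * Module.finrank (Γ.Fv k p r i) (Γ.Fv k p (r * ℓ) i) := by
    rw [← h3]
    ring
  exact (Nat.eq_of_mul_eq_mul_left (NeZero.pos (r * Γ.d i)) h4).symm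

variable {U : Γ.I → Type u} [∀ i, AddCommGroup (U i)] [∀ i, Module (Γ.Fv k p (r * ℓ) i) (U i)]
  [∀ i, Module (Γ.Fv k p r i) (U i)] [∀ i, IsScalarTower (Γ.Fv k p r i) (Γ.Fv k p (r * ℓ) i) (U i)]

/-! ### Graded subspaces over the larger and the smaller fields -/

/-- The graded `𝔽_q`-subspace underlying a graded `𝔽_{q ^ ℓ}`-subspace. -/
noncomputable def resGr (W : Γ.GrSub k p (r * ℓ) U) : Γ.GrSub k p r U :=
  fun i => (W i).restrictScalars (Γ.Fv k p r i)

theorem resGr_injective :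
    Function.Injective (resGr : Γ.GrSub k p (r * ℓ) U → Γ.GrSub k p r U) := fun _ _ h =>
  funext fun i => Submodule.restrictScalars_injective _ _ _ (congrFun h i)

theorem dim_resGr [IsAlgClosed k] [Finite J] [NeZero r] [NeZero ℓ]
    (W : Γ.GrSub k p (r * ℓ) U) (i : Γ.I) :
    dim k p r (fun i => (resGr W : Γ.GrSub k p r U) i) i =
      ℓ * dim k p (r * ℓ) (fun i => W i) i := by
  have h := Module.finrank_mul_finrank (Γ.Fv k p r i) (Γ.Fv k p (r * ℓ) i) (W i)
  rw [finrank_Fv] at h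
  exact h.symm

/-- Stability of a graded `𝔽_q`-subspace under the scalars from `𝔽_{q ^ ℓ}`. -/
def ScalStable (W : Γ.GrSub k p r U) : Prop :=
  ∀ (a : GF k p (r * ℓ)) i, ∀ v ∈ W i, scalV i a • v ∈ W i

theorem scalStable_resGr (W : Γ.GrSub k p (r * ℓ) U) :
    ScalStable (ℓ := ℓ) (resGr W : Γ.GrSub k p r U) :=
  fun a i _ hv => (W i).smul_mem (scalV i a) hv

section Coprime

variable [IsAlgClosed k] [Finite J] [NeZero r] [NeZero ℓ]

/-- `W i` is stable under `𝔽_{q ^ d_i}` as a subspace and under `𝔽_{q ^ ℓ}` by hypothesis; products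
of such scalars generate `𝔽_{q ^ (ℓ d_i)}` additively. -/
theorem ScalStable.smul_mem {W : Γ.GrSub k p r U} (hW : ScalStable (ℓ := ℓ) W)
    {i : Γ.I} (hd : Nat.Coprime ℓ (Γ.d i)) (c : Γ.Fv k p (r * ℓ) i) {v : U i} (hv : v ∈ W i) :
    c • v ∈ W i := by
  suffices h : ∀ h : c.1 ∈ GF k p (r * ℓ * Γ.d i), ∀ v ∈ W i, mkFv i c.1 h • v ∈ W i from
    h c.2 v hv
  refine GF_induction_of_coprime (p := p) (r := r) hd (P := fun x => ∀ h, ∀ v ∈ W i, mkFv i x h • v ∈ W i)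
    (fun a ha b hb h v hv => ?_) (fun x y hx hy hx' hy' h v hv => ?_) c.2
  · have : mkFv i (a * b) h =
        algebraMap (Γ.Fv k p r i) (Γ.Fv k p (r * ℓ) i) (mkFv i a ha) * scalV i ⟨b, hb⟩ := rfl
    rw [this, mul_smul, algebraMap_smul]
    exact (W i).smul_mem _ (hW ⟨b, hb⟩ i v hv)
  · have : mkFv i (x + y) h = mkFv i x hx + mkFv i y hy := rfl
    rw [this, add_smul]
    exact (W i).add_mem (hx' hx v hv) (hy' hy v hv)

theorem ScalStable.exists_resGr {W : Γ.GrSub k p r U} (hW : ScalStable (ℓ := ℓ) W)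
    (hd : ∀ i, Nat.Coprime ℓ (Γ.d i)) : ∃ W' : Γ.GrSub k p (r * ℓ) U, resGr W' = W :=
  ⟨fun i => { (W i).toAddSubmonoid with smul_mem' := fun c _ hv => hW.smul_mem (hd i) c hv },
    rfl⟩

omit [Finite J] in
-- Stability under `ι_ℓ(x)` only controls `x κ (c ⊗ v)` for `c` in the smaller field `𝔽_{q ^ e_κ}`.
-- A general `c` is a sum of products `a b` with `a` in that field and `b ∈ 𝔽_{q ^ ℓ}`, and `b`
-- comes out as a scalar preserving `W`.
theorem stable_iota_resGr_iff [Finite H] (he : ∀ κ, Nat.Coprime ℓ (Γ.e κ)) (x : Γ.E k p (r * ℓ) U)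
    (W : Γ.GrSub k p (r * ℓ) U) :
    Stable (iota x : Γ.E k p r U) (resGr W) ↔ Stable x W := by
  refine ⟨fun h κ c v hv => ?_, fun h κ c v hv => h κ _ v hv⟩
  suffices h : ∀ h : c.1 ∈ GF k p (r * ℓ * Γ.e κ), x κ (mkFe κ c.1 h ⊗ₜ v) ∈ W (Γ.tgt κ) from h c.2
  refine GF_induction_of_coprime (p := p) (r := r) (he κ)
    (P := fun z => ∀ h, x κ (mkFe κ z h ⊗ₜ v) ∈ W (Γ.tgt κ))
    (fun a ha b hb h' => ?_) (fun y z hy hz hy' hz' h' => ?_) c.2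
  · have : mkFe κ (a * b) h' = scalE κ ⟨b, hb⟩ * inclE k p r ℓ κ (mkFe κ a ha) :=
      Subtype.ext (mul_comm a b)
    rw [this, E_tmul_scalE_mul]
    exact (W _).smul_mem _ (h κ (mkFe κ a ha) v hv)
  · have : mkFe κ (y + z) h' = mkFe κ y hy + mkFe κ z hz := rfl
    rw [this, TensorProduct.add_tmul, map_add]
    exact (W _).add_mem (hy' hy) (hz' hz)

theorem isFlag_iota_resGr_iff [Finite H] (he : ∀ κ, Nat.Coprime ℓ (Γ.e κ)) (x : Γ.E k p (r * ℓ) U) {n : ℕ}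
    (i : Fin n → Γ.I) (c : Fin n → ℕ) (F : Fin (n + 1) → Γ.GrSub k p (r * ℓ) U) :
    IsFlag (iota x : Γ.E k p r U) i (fun a => ℓ * c a) (fun a => resGr (F a)) ↔ IsFlag x i c F := by
  unfold IsFlag
  simp only [stable_iota_resGr_iff he, dim_resGr]
  refine and_congr (resGr_injective.eq_iff' rfl) (and_congr (resGr_injective.eq_iff' rfl)
    (and_congr Iff.rfl (forall_congr' fun a => and_congr Iff.rfl (forall_congr' fun j => ?_))))
  rw [← mul_ite_zero, ← mul_add, Nat.mul_right_inj (NeZero.ne ℓ)]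

/-- `c a` is the difference of two dimensions, each a multiple of `ℓ`. -/
theorem IsFlag.dvd_of_resGr {x : Γ.E k p r U} {n : ℕ}
    {i : Fin n → Γ.I} {c : Fin n → ℕ} {F : Fin (n + 1) → Γ.GrSub k p (r * ℓ) U}
    (h : IsFlag x i c (fun a => resGr (F a))) (a : Fin n) : ℓ ∣ c a := by
  have := (h.2.2.2 a).2 (i a)
  simp only [dim_resGr, if_true] at this
  exact (Nat.dvd_add_right (Nat.dvd_mul_right _ _)).1 (this ▸ Nat.dvd_mul_right _ _)

end Coprime

/-! ### The action of `𝔽_{q ^ ℓ}ˣ` on flags -/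

/-- The action of a nonzero scalar from `𝔽_{q ^ ℓ}`. -/
noncomputable def scale (a : (GF k p (r * ℓ))ˣ) (i : Γ.I) : U i ≃ₗ[Γ.Fv k p r i] U i :=
  (DistribMulAction.toLinearEquiv (Γ.Fv k p (r * ℓ) i) (U i)
    (Units.map (scalV i : GF k p (r * ℓ) →+* Γ.Fv k p (r * ℓ) i).toMonoidHom a)).restrictScalars _

theorem scale_apply (a : (GF k p (r * ℓ))ˣ) (i : Γ.I) (v : U i) :
    (scale a i : U i ≃ₗ[Γ.Fv k p r i] U i) v = scalV i (a : GF k p (r * ℓ)) • v := rfl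

theorem intertwines_scale (a : (GF k p (r * ℓ))ˣ) (x : Γ.E k p (r * ℓ) U) :
    Intertwines (scale a) (iota x : Γ.E k p r U) (iota x) := by
  intro κ c v
  rw [scale_apply, scale_apply, iota_tmul, iota_tmul, E_tmul_scalV_smul]

/-- `𝔽_{q ^ ℓ}ˣ` acts on the `ι_ℓ(x)`-stable flags. -/
@[reducible] noncomputable def flagAction (x : Γ.E k p (r * ℓ) U) {n : ℕ} (i : Fin n → Γ.I)
    (c : Fin n → ℕ) : MulAction (GF k p (r * ℓ))ˣ
      {F : Fin (n + 1) → Γ.GrSub k p r U // IsFlag (iota x : Γ.E k p r U) i c F} where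
  smul a F := ⟨fun t => mapGr (scale a) (F.1 t), F.2.map (intertwines_scale a x)⟩
  one_smul F := by
    refine Subtype.ext (funext fun t => funext fun j => SetLike.coe_injective ?_)
    change (fun v => (scale 1 j : U j ≃ₗ[Γ.Fv k p r j] U j) v) '' (F.1 t j : Set (U j)) = _
    simp [scale_apply]
  mul_smul a b F := by
    refine Subtype.ext (funext fun t => funext fun j => SetLike.coe_injective ?_)
    change (fun v => (scale (a * b) j : U j ≃ₗ[Γ.Fv k p r j] U j) v) '' (F.1 t j : Set (U j)) =
      (fun v => (scale a j : U j ≃ₗ[Γ.Fv k p r j] U j) v) ''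
        ((fun v => (scale b j : U j ≃ₗ[Γ.Fv k p r j] U j) v) '' (F.1 t j : Set (U j)))
    simp [scale_apply, Set.image_image, mul_smul]

/-- Scaling preserves dimensions, so an inclusion between `W` and its image is an equality. -/
theorem mapGr_scale_eq_iff [∀ i, Finite (U i)] (a : (GF k p (r * ℓ))ˣ) (W : Γ.GrSub k p r U) :
    mapGr (scale a) W = W ↔ ∀ i, ∀ v ∈ W i, scalV i (a : GF k p (r * ℓ)) • v ∈ W i := by
  refine ⟨fun h i v hv => ?_, fun h => funext fun i => ?_⟩
  · have h' : scalV i (a : GF k p (r * ℓ)) • v ∈ mapGr (scale a) W i := ⟨v, hv, rfl⟩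
    rwa [h] at h'
  · refine Submodule.eq_of_le_of_finrank_eq ?_ ((scale a i).finrank_map_eq (W i))
    rintro _ ⟨v, hv, rfl⟩
    exact h i v hv

/-- The scalars from `𝔽_{q ^ ℓ}` that preserve all the given graded subspaces. -/
noncomputable def stabRing {T : Type*} (ℓ : ℕ) [∀ i, Module (Γ.Fv k p (r * ℓ) i) (U i)]
    (F : T → Γ.GrSub k p r U) : Subring k where
  carrier := {z | ∃ hz : z ∈ GF k p (r * ℓ), ∀ t i, ∀ v ∈ F t i,
    scalV i (⟨z, hz⟩ : GF k p (r * ℓ)) • v ∈ F t i}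
  zero_mem' := ⟨zero_mem _, fun t i v _ => by
    change scalV i (0 : GF k p (r * ℓ)) • v ∈ F t i
    simp⟩
  one_mem' := ⟨one_mem _, fun t i v hv => by
    change scalV i (1 : GF k p (r * ℓ)) • v ∈ F t i
    simpa using hv⟩
  add_mem' := fun {y z} ⟨hy, hy'⟩ ⟨hz, hz'⟩ => ⟨add_mem hy hz, fun t i v hv => by
    change scalV i ((⟨y, hy⟩ + ⟨z, hz⟩ : GF k p (r * ℓ))) • v ∈ F t i
    rw [map_add, add_smul]
    exact add_mem (hy' t i v hv) (hz' t i v hv)⟩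
  mul_mem' := fun {y z} ⟨hy, hy'⟩ ⟨hz, hz'⟩ => ⟨mul_mem hy hz, fun t i v hv => by
    change scalV i ((⟨y, hy⟩ * ⟨z, hz⟩ : GF k p (r * ℓ))) • v ∈ F t i
    rw [map_mul, mul_smul]
    exact hy' t i _ (hz' t i v hv)⟩
  neg_mem' := fun {y} ⟨hy, hy'⟩ => ⟨neg_mem hy, fun t i v hv => by
    change scalV i (-(⟨y, hy⟩ : GF k p (r * ℓ))) • v ∈ F t i
    rw [map_neg, neg_smul]
    exact neg_mem (hy' t i v hv)⟩

omit [∀ i, IsScalarTower (Γ.Fv k p r i) (Γ.Fv k p (r * ℓ) i) (U i)] in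
theorem stabRing_le {T : Type*} (F : T → Γ.GrSub k p r U) :
    stabRing ℓ F ≤ (GF k p (r * ℓ)).toSubring := fun _ hz => hz.1

/-- A scalar of `𝔽_q` acts through `𝔽_{q ^ d_i}`, over which each member of the family is already a
subspace. -/
theorem le_stabRing {T : Type*} (F : T → Γ.GrSub k p r U) :
    (GF k p r).toSubring ≤ stabRing ℓ F := fun z hz =>
  ⟨GF_mono k p (Nat.dvd_mul_right r ℓ) hz, fun t i v hv => by
    have := (F t i).smul_mem (scalV i ⟨z, hz⟩) hv
    rwa [← algebraMap_smul (Γ.Fv k p (r * ℓ) i)] at this⟩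

omit [∀ i, IsScalarTower (Γ.Fv k p r i) (Γ.Fv k p (r * ℓ) i) (U i)] in
theorem stabRing_eq_iff {T : Type*} (F : T → Γ.GrSub k p r U) :
    stabRing ℓ F = (GF k p (r * ℓ)).toSubring ↔ ∀ t, ScalStable (ℓ := ℓ) (F t) := by
  refine ⟨fun h t a i v hv => ?_, fun h => le_antisymm (stabRing_le F) fun z hz =>
    ⟨hz, fun t i v hv => h t _ i v hv⟩⟩
  obtain ⟨_, ha⟩ := h.ge a.2
  exact ha t i v hv

theorem mem_fixedPoints_flagAction_iff [∀ i, Finite (U i)] (x : Γ.E k p (r * ℓ) U) {n : ℕ} {i : Fin n → Γ.I}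
    {c : Fin n → ℕ}
    (F : {F : Fin (n + 1) → Γ.GrSub k p r U // IsFlag (iota x : Γ.E k p r U) i c F}) :
    letI := flagAction x i c
    F ∈ MulAction.fixedPoints (GF k p (r * ℓ))ˣ
        {F : Fin (n + 1) → Γ.GrSub k p r U // IsFlag (iota x : Γ.E k p r U) i c F} ↔
      ∀ t, ScalStable (ℓ := ℓ) (F.1 t) := by
  have key (a : (GF k p (r * ℓ))ˣ) : (flagAction x i c).smul a F = F ↔
      ∀ t i, ∀ v ∈ F.1 t i, scalV i (a : GF k p (r * ℓ)) • v ∈ F.1 t i := by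
    rw [Subtype.ext_iff, funext_iff]
    exact forall_congr' fun t => mapGr_scale_eq_iff a (F.1 t)
  refine ⟨fun h t a j v hv => ?_, fun h a => (key a).2 fun t => h t a⟩
  -- The group contains only the nonzero scalars; zero preserves every subspace.
  by_cases ha : a = 0
  · simp [ha]
  · exact (key (Units.mk0 a ha)).1 (h _) t j v hv

/-! ### Counting flags modulo `Φ_ℓ(q)`. -/

section Count

variable [IsAlgClosed k] [NeZero r] [NeZero ℓ]

/-- Adding zero to the stabilizer of `F` gives the ring `stabRing ℓ F.1`, of size `q ^ m`. Hence the
orbit size times `q ^ m - 1` is `q ^ ℓ - 1`, and `m < ℓ` since some scalar moves `F`. -/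
theorem cyclotomic_dvd_card_orbit [∀ i, Finite (U i)] (x : Γ.E k p (r * ℓ) U) {n : ℕ} {i : Fin n → Γ.I}
    {c : Fin n → ℕ}
    (F : {F : Fin (n + 1) → Γ.GrSub k p r U // IsFlag (iota x : Γ.E k p r U) i c F})
    (hF : ¬ ∀ t, ScalStable (ℓ := ℓ) (F.1 t)) :
    letI := flagAction x i c
    (Polynomial.cyclotomic ℓ ℤ).eval ((p ^ r : ℕ) : ℤ) ∣
      Nat.card (MulAction.orbit (GF k p (r * ℓ))ˣ F) := by
  let _ := flagAction x i c
  have hGF : Finite (GF k p (r * ℓ)) := inferInstance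
  have hGF' : Finite (GF k p (r * ℓ)).toSubring := hGF
  have hfin : Finite (stabRing ℓ F.1) := Finite.of_injective _
    (Subring.inclusion_injective (stabRing_le (ℓ := ℓ) F.1))
  have hmem (a : (GF k p (r * ℓ))ˣ) : a ∈ MulAction.stabilizer (GF k p (r * ℓ))ˣ F ↔
      ((a : GF k p (r * ℓ)) : k) ∈ stabRing ℓ F.1 := by
    refine Iff.trans ?_ ⟨fun h => ⟨a.1.2, h⟩, fun ⟨_, h⟩ => h⟩
    rw [MulAction.mem_stabilizer_iff, Subtype.ext_iff, funext_iff]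
    exact forall_congr' fun t => mapGr_scale_eq_iff a (F.1 t)
  have hset : (stabRing ℓ F.1 : Set k) = insert 0 ((fun a : (GF k p (r * ℓ))ˣ =>
      ((a : GF k p (r * ℓ)) : k)) '' (MulAction.stabilizer (GF k p (r * ℓ))ˣ F)) := by
    ext z
    simp only [Set.mem_insert_iff, Set.mem_image, SetLike.mem_coe, hmem]
    constructor
    · intro hz
      by_cases h0 : z = 0
      · exact Or.inl h0
      · refine Or.inr ⟨Units.mk0 ⟨z, hz.1⟩ fun h => h0 (congrArg Subtype.val h), hz, rfl⟩
    · rintro (rfl | ⟨a, ha, rfl⟩)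
      · exact zero_mem _
      · exact ha
  have hcard : Nat.card (stabRing ℓ F.1) =
      Nat.card (MulAction.stabilizer (GF k p (r * ℓ))ˣ F) + 1 := by
    change (stabRing ℓ F.1 : Set k).ncard = _
    rw [hset, Set.ncard_insert_of_notMem, Set.ncard_image_of_injective]
    · rfl
    · exact fun a b h => Units.ext (Subtype.ext h)
    · rintro ⟨a, -, ha⟩
      exact a.ne_zero (Subtype.ext ha)
  obtain ⟨m, hm⟩ := Subfield.exists_card_eq_pow (GF k p r) (stabRing ℓ F.1) (le_stabRing F.1)
  rw [card_GF] at hm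
  have hq : 1 < p ^ r := Nat.one_lt_pow (NeZero.ne r) (Fact.out : p.Prime).one_lt
  have hlt : Nat.card (stabRing ℓ F.1) < Nat.card (GF k p (r * ℓ)) := by
    refine Set.ncard_lt_ncard (s := (stabRing ℓ F.1 : Set k)) (t := (GF k p (r * ℓ) : Set k)) ?_
      hGF
    refine lt_of_le_of_ne (stabRing_le F.1) fun h => hF ((stabRing_eq_iff F.1).1 ?_)
    exact SetLike.coe_injective h
  rw [hm, card_GF, pow_mul] at hlt
  refine Polynomial.cyclotomic_eval_dvd_of_mul_eq (m := m) hq ?_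
    ((Nat.pow_lt_pow_iff_right hq).1 hlt) ?_
  -- For `m = 0` the ring would have one element, whereas it contains zero and the nonempty
  -- stabilizer.
  · rintro rfl
    have : 0 < Nat.card (MulAction.stabilizer (GF k p (r * ℓ))ˣ F) := Nat.card_pos
    rw [pow_zero] at hm
    omega
  · have h1 := Subgroup.index_mul_card (MulAction.stabilizer (GF k p (r * ℓ))ˣ F)
    rw [MulAction.index_stabilizer, Nat.card_units, card_GF, pow_mul] at h1
    rw [← h1, ← hm, hcard]
    rfl

theorem cyclotomic_dvd_flagCount_iota_sub [Finite J] [∀ i, Finite (U i)]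
    (x : Γ.E k p (r * ℓ) U) {n : ℕ} (i : Fin n → Γ.I)
    (c : Fin n → ℕ) :
    (Polynomial.cyclotomic ℓ ℤ).eval ((p ^ r : ℕ) : ℤ) ∣
      (flagCount (iota x : Γ.E k p r U) i c : ℤ) -
        Nat.card {F : {F : Fin (n + 1) → Γ.GrSub k p r U // IsFlag (iota x : Γ.E k p r U) i c F} //
          ∀ t, ScalStable (ℓ := ℓ) (F.1 t)} := by
  let _ := flagAction x i c
  have h := MulAction.dvd_card_sub_card_fixedPoints (G := (GF k p (r * ℓ))ˣ)
    (α := {F : Fin (n + 1) → Γ.GrSub k p r U // IsFlag (iota x : Γ.E k p r U) i c F})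
    ((Polynomial.cyclotomic ℓ ℤ).eval ((p ^ r : ℕ) : ℤ)) fun F hF =>
      cyclotomic_dvd_card_orbit x F fun h => hF ((mem_fixedPoints_flagAction_iff x F).2 h)
  rwa [Nat.card_congr (Equiv.subtypeEquivRight fun F => mem_fixedPoints_flagAction_iff x F)] at h

/-- Restriction of scalars is a bijection from the `x`-stable flags over the large fields onto these
flags: surjectivity is `ScalStable.exists_resGr` applied to each term. -/
theorem card_scalStable_flags [Finite J] [Finite H]
    (hd : ∀ i, Nat.Coprime ℓ (Γ.d i)) (he : ∀ κ, Nat.Coprime ℓ (Γ.e κ))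
    (x : Γ.E k p (r * ℓ) U) {n : ℕ} (i : Fin n → Γ.I) (c : Fin n → ℕ) :
    Nat.card {F : {F : Fin (n + 1) → Γ.GrSub k p r U //
        IsFlag (iota x : Γ.E k p r U) i (fun a => ℓ * c a) F} // ∀ t, ScalStable (ℓ := ℓ) (F.1 t)} =
      flagCount x i c := by
  refine (Nat.card_congr (Equiv.ofBijective (fun F => ⟨⟨fun t => resGr (F.1 t),
    (isFlag_iota_resGr_iff he x i c F.1).2 F.2⟩, fun t => scalStable_resGr _⟩) ⟨?_, ?_⟩)).symm
  · intro F F' h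
    exact Subtype.ext (funext fun t => resGr_injective (congrFun (congrArg (fun F => F.1.1) h) t))
  · rintro ⟨⟨F, hF⟩, hs⟩
    choose F' hF' using fun t => (hs t).exists_resGr hd
    obtain rfl : (fun t => resGr (F' t)) = F := funext hF'
    exact ⟨⟨F', (isFlag_iota_resGr_iff he x i c F').1 hF⟩, rfl⟩

theorem isEmpty_scalStable_flags [Finite J] (hd : ∀ i, Nat.Coprime ℓ (Γ.d i))
    (x : Γ.E k p r U) {n : ℕ} (i : Fin n → Γ.I) (c : Fin n → ℕ)
    (hc : ∃ a, ¬ ℓ ∣ c a) :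
    IsEmpty {F : {F : Fin (n + 1) → Γ.GrSub k p r U // IsFlag x i c F} //
      ∀ t, ScalStable (ℓ := ℓ) (F.1 t)} := by
  refine ⟨?_⟩
  rintro ⟨⟨F, hF⟩, hs⟩
  choose F' hF' using fun t => (hs t).exists_resGr hd
  obtain rfl : (fun t => resGr (F' t)) = F := funext hF'
  obtain ⟨a, ha⟩ := hc
  exact ha (hF.dvd_of_resGr a)

end Count

/-! ### The values of `Q` on the flag functions -/

section Values

variable {R : Type} [CommRing R]

theorem ev_flagFun {V : Γ.I → Type u} [∀ i, AddCommGroup (V i)]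
    [∀ i, Module (Γ.Fv k p r i) (V i)] [∀ i, Finite (V i)] {n : ℕ} (i : Fin n → Γ.I)
    (c : Fin n → ℕ) (x : Γ.E k p r V) : ev (flagFun k p r R i c) x = flagCount x i c :=
  congrArg Nat.cast (flagCount_congr (intertwines_transport coord x) i c).symm

variable [IsAlgClosed k] [Finite J] [NeZero r] [NeZero ℓ]

/-- The nonfixed flags contribute a multiple of `Φ_ℓ(q)`, which is zero in `R`. -/
theorem frobQ_flagFun_apply
    (hR : (((Polynomial.cyclotomic ℓ ℤ).eval ((p ^ r : ℕ) : ℤ) : ℤ) : R) = 0) {n : ℕ}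
    (i : Fin n → Γ.I) (c : Fin n → ℕ) (μ : Γ.I → ℕ) (x : Γ.E k p (r * ℓ) (Γ.Std k p (r * ℓ) μ)) :
    (Γ.frobQ k p r R ℓ (flagFun k p r R i c)).1 μ x =
      (Nat.card {F : {F : Fin (n + 1) → Γ.GrSub k p r (Γ.Std k p (r * ℓ) μ) //
        IsFlag (iota x : Γ.E k p r _) i c F} // ∀ t, ScalStable (ℓ := ℓ) (F.1 t)} : R) := by
  refine (ev_flagFun (R := R) i c (iota x : Γ.E k p r (Γ.Std k p (r * ℓ) μ))).trans ?_
  obtain ⟨z, hz⟩ := cyclotomic_dvd_flagCount_iota_sub x i c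
  have := congrArg (Int.cast : ℤ → R) hz
  rw [Int.cast_mul, hR, zero_mul, Int.cast_sub, Int.cast_natCast, Int.cast_natCast] at this
  exact sub_eq_zero.1 this

theorem frobQ_flagFun_mul [Finite H]
    (hd : ∀ i, Nat.Coprime ℓ (Γ.d i)) (he : ∀ κ, Nat.Coprime ℓ (Γ.e κ))
    (hR : (((Polynomial.cyclotomic ℓ ℤ).eval ((p ^ r : ℕ) : ℤ) : ℤ) : R) = 0) {n : ℕ}
    (i : Fin n → Γ.I) (c : Fin n → ℕ) :
    Γ.frobQ k p r R ℓ (flagFun k p r R i (fun a => ℓ * c a)) = flagFun k p (r * ℓ) R i c := by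
  refine Subtype.ext (funext fun μ => funext fun x => ?_)
  rw [frobQ_flagFun_apply hR, card_scalStable_flags hd he]
  rfl

theorem frobQ_flagFun_eq_zero (hd : ∀ i, Nat.Coprime ℓ (Γ.d i))
    (hR : (((Polynomial.cyclotomic ℓ ℤ).eval ((p ^ r : ℕ) : ℤ) : ℤ) : R) = 0) {n : ℕ}
    (i : Fin n → Γ.I) {c : Fin n → ℕ} (hc : ∃ a, ¬ ℓ ∣ c a) :
    Γ.frobQ k p r R ℓ (flagFun k p r R i c) = 0 := by
  refine Subtype.ext (funext fun μ => funext fun x => ?_)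
  have := isEmpty_scalStable_flags hd (iota x : Γ.E k p r _) i c hc
  rw [frobQ_flagFun_apply hR, Nat.card_of_isEmpty, Nat.cast_zero]
  rfl

end Values

end Scalars

end AutQuiver

namespace AutQuiver

section Product

variable {J : Type v} {H : Type w} {Γ : AutQuiver J H}
variable {k : Type u} [Field k] {p : ℕ} [Fact p.Prime] [CharP k p] {r : ℕ}
variable {V : Γ.I → Type u} [∀ i, AddCommGroup (V i)] [∀ i, Module (Γ.Fv k p r i) (V i)]

/-! ### Flags through a given stable subspace -/

/-- The preimage in `V` of a graded subspace of `V / W`. -/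
noncomputable def comapQ (W : Γ.GrSub k p r V) (B : Γ.GrSub k p r (fun i => V i ⧸ W i)) :
    Γ.GrSub k p r V := fun i => (B i).comap (W i).mkQ

/-- The image in `V` of a graded subspace of `W`. -/
noncomputable def mapS (W : Γ.GrSub k p r V) (C : Γ.GrSub k p r (fun i => W i)) :
    Γ.GrSub k p r V := fun i => (C i).map (W i).subtype

theorem comapQ_le_comapQ {W : Γ.GrSub k p r V} {A B : Γ.GrSub k p r (fun i => V i ⧸ W i)} :
    comapQ W A ≤ comapQ W B ↔ A ≤ B :=
  forall_congr' fun i => Submodule.comap_le_comap_iff_of_surjective (W i).mkQ_surjective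

theorem mapS_le_mapS {W : Γ.GrSub k p r V} {A B : Γ.GrSub k p r (fun i => W i)} :
    mapS W A ≤ mapS W B ↔ A ≤ B :=
  forall_congr' fun i => Submodule.map_le_map_iff_of_injective (W i).injective_subtype _ _

theorem comapQ_injective (W : Γ.GrSub k p r V) : Function.Injective (comapQ W) := fun _ _ h =>
  le_antisymm (comapQ_le_comapQ.1 h.le) (comapQ_le_comapQ.1 h.ge)

theorem mapS_injective (W : Γ.GrSub k p r V) : Function.Injective (mapS W) := fun _ _ h =>
  le_antisymm (mapS_le_mapS.1 h.le) (mapS_le_mapS.1 h.ge)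

theorem comapQ_top (W : Γ.GrSub k p r V) : comapQ W ⊤ = ⊤ := rfl

theorem comapQ_bot (W : Γ.GrSub k p r V) : comapQ W ⊥ = W := funext fun i => (W i).ker_mkQ

theorem mapS_top (W : Γ.GrSub k p r V) : mapS W ⊤ = W :=
  funext fun i => (Submodule.map_top _).trans (W i).range_subtype

theorem mapS_bot (W : Γ.GrSub k p r V) : mapS W ⊥ = ⊥ := funext fun _ => Submodule.map_bot _

theorem comapQ_map {W A : Γ.GrSub k p r V} (h : W ≤ A) :
    comapQ W (fun i => (A i).map (W i).mkQ) = A :=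
  funext fun i => Submodule.comap_map_mkQ (W i) (A i) |>.trans (sup_eq_right.2 (h i))

theorem mapS_comap {W A : Γ.GrSub k p r V} (h : A ≤ W) :
    mapS W (fun i => (A i).comap (W i).subtype) = A :=
  funext fun i => (Submodule.map_comap_subtype (W i) (A i)).trans (inf_eq_right.2 (h i))

theorem stable_comapQ_iff {x : Γ.E k p r V} {W : Γ.GrSub k p r V} (hW : Stable x W)
    (B : Γ.GrSub k p r (fun i => V i ⧸ W i)) : Stable x (comapQ W B) ↔ Stable (quot x W hW) B := by
  refine ⟨fun h κ c v hv => ?_, fun h κ c v hv => h κ c _ hv⟩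
  obtain ⟨v, rfl⟩ := Submodule.mkQ_surjective _ v
  exact h κ c v hv

theorem stable_mapS_iff {x : Γ.E k p r V} {W : Γ.GrSub k p r V} (hW : Stable x W)
    (C : Γ.GrSub k p r (fun i => W i)) : Stable x (mapS W C) ↔ Stable (restr x W hW) C := by
  constructor
  · intro h κ c v hv
    obtain ⟨w, hw, hw'⟩ := h κ c v ⟨v, hv, rfl⟩
    have : w = restr x W hW κ (c ⊗ₜ v) := Subtype.ext hw'
    exact this ▸ hw
  · rintro h κ c _ ⟨v, hv, rfl⟩
    exact ⟨_, h κ c v hv, rfl⟩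

theorem dim_comapQ [∀ i, Finite (V i)] (W : Γ.GrSub k p r V)
    (B : Γ.GrSub k p r (fun i => V i ⧸ W i)) (j : Γ.I) :
    dim k p r (fun j => comapQ W B j) j =
      dim k p r (fun j => B j) j + dim k p r (fun j => W j) j := by
  have h1 : Module.finrank (Γ.Fv k p r j) ((V j ⧸ W j) ⧸ B j) +
      Module.finrank (Γ.Fv k p r j) (B j) = Module.finrank (Γ.Fv k p r j) (V j ⧸ W j) :=
    Submodule.finrank_quotient_add_finrank (B j)
  have h2 := Submodule.finrank_quotient_add_finrank (W j)
  have h3 := Submodule.finrank_quotient_add_finrank (comapQ W B j)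
  -- `comapQ W B j` is the kernel of the composite of the two quotient maps, so `V / comapQ W B` and
  -- `(V / W) / B` have the same dimension.
  have hker : LinearMap.ker ((B j).mkQ ∘ₗ (W j).mkQ) = comapQ W B j := by
    rw [LinearMap.ker_comp, Submodule.ker_mkQ]
    rfl
  have h4 : Module.finrank (Γ.Fv k p r j) (V j ⧸ LinearMap.ker ((B j).mkQ ∘ₗ (W j).mkQ)) =
      Module.finrank (Γ.Fv k p r j) ((V j ⧸ W j) ⧸ B j) := (LinearMap.quotKerEquivOfSurjective ((B j).mkQ ∘ₗ (W j).mkQ)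
    ((B j).mkQ_surjective.comp (W j).mkQ_surjective)).finrank_eq
  rw [hker] at h4
  change Module.finrank (Γ.Fv k p r j) (comapQ W B j) =
    Module.finrank (Γ.Fv k p r j) (B j) + Module.finrank (Γ.Fv k p r j) (W j)
  omega

theorem dim_mapS (W : Γ.GrSub k p r V) (C : Γ.GrSub k p r (fun i => W i)) :
    dim k p r (fun j => mapS W C j) = dim k p r (fun j => C j) :=
  (dim_eq fun i => Submodule.equivMapOfInjective _ (W i).injective_subtype (C i)).symm

/-- The index `a` of a flag of length `n`, in the concatenation with a flag of length `n'`. -/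
def idxL {n : ℕ} (n' : ℕ) (a : Fin (n + 1)) : Fin (n + n' + 1) := ⟨a, by omega⟩

/-- The index `b` of a flag of length `n'`, in the concatenation of a flag of length `n` with it. -/
def idxR (n : ℕ) {n' : ℕ} (b : Fin (n' + 1)) : Fin (n + n' + 1) := ⟨n + b, by omega⟩

/-- The two ranges of indices overlap in `n`, which is both `idxL n' (Fin.last n)` and `idxR n 0`.
-/
theorem forall_idx_iff {n n' : ℕ} {P : Fin (n + n' + 1) → Prop} :
    (∀ t, P t) ↔ (∀ a, P (idxL n' a)) ∧ ∀ b, P (idxR n b) := by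
  refine ⟨fun h => ⟨fun _ => h _, fun _ => h _⟩, fun h t => ?_⟩
  rcases le_total t.1 n with ht | ht
  · exact h.1 ⟨t, by omega⟩
  · have : t = idxR n ⟨t - n, by omega⟩ := Fin.ext (by simp only [idxR]; omega)
    exact this ▸ h.2 _

theorem forall_fin_add_iff {n n' : ℕ} {P : Fin (n + n') → Prop} :
    (∀ t, P t) ↔ (∀ a, P (Fin.castAdd n' a)) ∧ ∀ b, P (Fin.natAdd n b) :=
  ⟨fun h => ⟨fun _ => h _, fun _ => h _⟩, fun h t => Fin.addCases h.1 h.2 t⟩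

open Classical in
theorem isFlag_append_iff [∀ i, Finite (V i)] {x : Γ.E k p r V} {W : Γ.GrSub k p r V}
    (hW : Stable x W)
    {n n' : ℕ} (i : Fin n → Γ.I) (c : Fin n → ℕ) (i' : Fin n' → Γ.I) (c' : Fin n' → ℕ)
    {F : Fin (n + n' + 1) → Γ.GrSub k p r V}
    {A : Fin (n + 1) → Γ.GrSub k p r (fun i => V i ⧸ W i)}
    {B : Fin (n' + 1) → Γ.GrSub k p r (fun i => W i)}
    (hA : ∀ a, F (idxL n' a) = comapQ W (A a)) (hB : ∀ b, F (idxR n b) = mapS W (B b)) :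
    IsFlag x (Fin.append i i') (Fin.append c c') F ↔
      IsFlag (quot x W hW) i c A ∧ IsFlag (restr x W hW) i' c' B := by
  -- At the shared index the term coming from `A` contains `W` and the one coming from `B` lies in
  -- `W`. Being equal, both are `W`, which supplies the end condition of `A` and the initial
  -- condition of `B`.
  have hlast : A (Fin.last n) = ⊥ ∧ B 0 = ⊤ := by
    have h : comapQ W (A (Fin.last n)) = mapS W (B 0) := by rw [← hA, ← hB]; rfl
    constructor
    · refine le_bot_iff.1 (comapQ_le_comapQ.1 ?_)
      rw [h, comapQ_bot]
      exact fun i => Submodule.map_subtype_le _ _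
    · refine top_le_iff.1 (mapS_le_mapS.1 ?_)
      rw [← h, mapS_top]
      nth_rewrite 1 [← comapQ_bot W]
      exact comapQ_le_comapQ.2 bot_le
  have h0 : F 0 = ⊤ ↔ A 0 = ⊤ := by
    change F (idxL n' 0) = ⊤ ↔ _
    rw [hA, ← comapQ_top W, (comapQ_injective W).eq_iff]
  have hn : F (Fin.last (n + n')) = ⊥ ↔ B (Fin.last n') = ⊥ := by
    change F (idxR n (Fin.last n')) = ⊥ ↔ _
    rw [hB, ← mapS_bot W, (mapS_injective W).eq_iff]
  have hs : (∀ t, Stable x (F t)) ↔ (∀ a, Stable (quot x W hW) (A a)) ∧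
      ∀ b, Stable (restr x W hW) (B b) := by
    simp only [forall_idx_iff (n := n) (n' := n'), hA, hB, stable_comapQ_iff hW, stable_mapS_iff hW]
  have hdL (a : Fin (n + 1)) (j : Γ.I) : dim k p r (fun j => F (idxL n' a) j) j =
      dim k p r (fun j => A a j) j + dim k p r (fun j => W j) j := by
    rw [hA]
    exact dim_comapQ W (A a) j
  have hdR (b : Fin (n' + 1)) (j : Γ.I) : dim k p r (fun j => F (idxR n b) j) j =
      dim k p r (fun j => B b j) j := by
    rw [hB]
    exact congrFun (dim_mapS W (B b)) j
  have hL (a : Fin n) : (F (Fin.castAdd n' a).succ ≤ F (Fin.castAdd n' a).castSucc ∧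
      ∀ j, dim k p r (fun j => F (Fin.castAdd n' a).castSucc j) j =
        dim k p r (fun j => F (Fin.castAdd n' a).succ j) j +
          if j = Fin.append i i' (Fin.castAdd n' a) then Fin.append c c' (Fin.castAdd n' a) else 0) ↔
      A a.succ ≤ A a.castSucc ∧ ∀ j, dim k p r (fun j => A a.castSucc j) j =
        dim k p r (fun j => A a.succ j) j + if j = i a then c a else 0 := by
    refine and_congr ?_ (forall_congr' fun j => ?_)
    · change F (idxL n' a.succ) ≤ F (idxL n' a.castSucc) ↔ _
      rw [hA, hA, comapQ_le_comapQ]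
    · change dim k p r (fun j => F (idxL n' a.castSucc) j) j =
        dim k p r (fun j => F (idxL n' a.succ) j) j + _ ↔ _
      rw [hdL, hdL, Fin.append_left, Fin.append_left, add_right_comm, add_left_inj]
  have hR (b : Fin n') : (F (Fin.natAdd n b).succ ≤ F (Fin.natAdd n b).castSucc ∧
      ∀ j, dim k p r (fun j => F (Fin.natAdd n b).castSucc j) j =
        dim k p r (fun j => F (Fin.natAdd n b).succ j) j +
          if j = Fin.append i i' (Fin.natAdd n b) then Fin.append c c' (Fin.natAdd n b) else 0) ↔
      B b.succ ≤ B b.castSucc ∧ ∀ j, dim k p r (fun j => B b.castSucc j) j =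
        dim k p r (fun j => B b.succ j) j + if j = i' b then c' b else 0 := by
    refine and_congr ?_ (forall_congr' fun j => ?_)
    · change F (idxR n b.succ) ≤ F (idxR n b.castSucc) ↔ _
      rw [hB, hB, mapS_le_mapS]
    · change dim k p r (fun j => F (idxR n b.castSucc) j) j =
        dim k p r (fun j => F (idxR n b.succ) j) j + _ ↔ _
      rw [hdR, hdR, Fin.append_right, Fin.append_right]
  refine Iff.trans (and_congr h0 (and_congr hn (and_congr hs (forall_fin_add_iff.trans
    (and_congr (forall_congr' hL) (forall_congr' hR)))))) ?_
  unfold IsFlag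
  tauto

theorem IsFlag.antitone {x : Γ.E k p r V} {n : ℕ} {i : Fin n → Γ.I} {c : Fin n → ℕ}
    {F : Fin (n + 1) → Γ.GrSub k p r V} (h : IsFlag x i c F) : Antitone F :=
  Fin.antitone_iff_succ_le.2 fun a => (h.2.2.2 a).1

/-- A flag with `n`-th term `W` amounts to a flag of `V / W` (its terms above `W`) and a flag of `W`
(its terms below). -/
theorem card_flags_through [∀ i, Finite (V i)] {x : Γ.E k p r V} {W : Γ.GrSub k p r V}
    (hW : Stable x W)
    {n n' : ℕ} (i : Fin n → Γ.I) (c : Fin n → ℕ) (i' : Fin n' → Γ.I) (c' : Fin n' → ℕ) :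
    Nat.card {F : {F // IsFlag x (Fin.append i i') (Fin.append c c') F} //
        F.1 (idxR n 0) = W} =
      flagCount (quot x W hW) i c * flagCount (restr x W hW) i' c' := by
  unfold flagCount
  rw [← Nat.card_prod]
  symm
  have key (A : {A // IsFlag (quot x W hW) i c A}) (B : {B // IsFlag (restr x W hW) i' c' B}) :
      ∃ F : Fin (n + n' + 1) → Γ.GrSub k p r V, (∀ a, F (idxL n' a) = comapQ W (A.1 a)) ∧
        ∀ b, F (idxR n b) = mapS W (B.1 b) := by
    refine ⟨fun t => if h : t.1 < n + 1 then comapQ W (A.1 ⟨t, h⟩) else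
      mapS W (B.1 ⟨t - n, by omega⟩), fun a => dif_pos a.2, fun b => ?_⟩
    -- The shared index falls into the branch defined by `A`; there both formulas give `W`.
    by_cases hb : b = 0
    · subst hb
      refine (dif_pos (Nat.lt_succ_self n)).trans ?_
      rw [B.2.1, mapS_top]
      exact (congrArg (comapQ W) A.2.2.1).trans (comapQ_bot W)
    · have hb' : b.1 ≠ 0 := fun h => hb (Fin.ext h)
      refine (dif_neg (by simp only [idxR]; omega)).trans ?_
      exact congrArg (fun b => mapS W (B.1 b)) (Fin.ext (Nat.add_sub_cancel_left n b.1))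
  choose F hA hB using key
  refine Nat.card_congr (Equiv.ofBijective (fun AB => ⟨⟨F AB.1 AB.2,
    (isFlag_append_iff hW i c i' c' (hA _ _) (hB _ _)).2 ⟨AB.1.2, AB.2.2⟩⟩, ?_⟩) ⟨?_, ?_⟩)
  · change F AB.1 AB.2 (idxR n 0) = W
    rw [hB, AB.2.2.1, mapS_top]
  · rintro ⟨A, B⟩ ⟨A', B'⟩ h
    have h' : F A B = F A' B' := congrArg (fun F => F.1.1) h
    refine Prod.ext (Subtype.ext (funext fun a => comapQ_injective W ?_))
      (Subtype.ext (funext fun b => mapS_injective W ?_))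
    · rw [← hA A B, ← hA A' B', h']
    · rw [← hB A B, ← hB A' B', h']
  · rintro ⟨⟨G, hG⟩, rfl⟩
    change Stable x (G (idxR n 0)) at hW
    have hanti := hG.antitone
    have hGA (a : Fin (n + 1)) : G (idxL n' a) =
        comapQ (G (idxR n 0)) (fun i => (G (idxL n' a) i).map (G (idxR n 0) i).mkQ) :=
      (comapQ_map (hanti (Fin.mk_le_mk.2 (Nat.lt_succ_iff.1 a.2)))).symm
    have hGB (b : Fin (n' + 1)) : G (idxR n b) =
        mapS (G (idxR n 0)) (fun i => (G (idxR n b) i).comap (G (idxR n 0) i).subtype) :=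
      (mapS_comap (hanti (Fin.mk_le_mk.2 (Nat.le_add_right n b)))).symm
    obtain ⟨h1, h2⟩ := (isFlag_append_iff hW i c i' c' hGA hGB).1 hG
    refine ⟨⟨⟨_, h1⟩, ⟨_, h2⟩⟩, Subtype.ext (Subtype.ext (funext ?_))⟩
    refine forall_idx_iff.2 ⟨fun a => ?_, fun b => ?_⟩
    · exact (hA _ _ a).trans (hGA a).symm
    · exact (hB _ _ b).trans (hGB b).symm

/-- Sort the flags of the concatenated type by their `n`-th term. -/
theorem finsum_flagCount_mul [Finite J] [∀ i, Finite (V i)] (x : Γ.E k p r V)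
    {n n' : ℕ} (i : Fin n → Γ.I) (c : Fin n → ℕ) (i' : Fin n' → Γ.I) (c' : Fin n' → ℕ) :
    ∑ᶠ W : {W : Γ.GrSub k p r V // Stable x W},
        flagCount (quot x W.1 W.2) i c * flagCount (restr x W.1 W.2) i' c' =
      flagCount x (Fin.append i i') (Fin.append c c') := by
  classical
  have := Fintype.ofFinite {W : Γ.GrSub k p r V // Stable x W}
  rw [finsum_eq_sum_of_fintype]
  let φ : {F // IsFlag x (Fin.append i i') (Fin.append c c') F} →
    {W : Γ.GrSub k p r V // Stable x W} := fun F => ⟨F.1 (idxR n 0), F.2.2.2.1 _⟩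
  refine Eq.symm ((Nat.card_congr (Equiv.sigmaFiberEquiv φ).symm).trans ?_)
  rw [Nat.card_sigma]
  refine Finset.sum_congr rfl fun W _ => ?_
  rw [← card_flags_through]
  exact Nat.card_congr (Equiv.subtypeEquivRight fun F => Subtype.ext_iff)

/-! ### The product of flag functions -/

open Classical in
/-- The element `∑ c_a i_a` of `ℕI`. -/
noncomputable def wt {n : ℕ} (i : Fin n → Γ.I) (c : Fin n → ℕ) (j : Γ.I) : ℕ :=
  ∑ a, if j = i a then c a else 0

variable [Fintype J] [Fintype H] {R : Type} [CommRing R]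

theorem mulAt_flagFun (ε : Rˣ) [∀ i, Finite (V i)] (x : Γ.E k p r V)
    {n n' : ℕ} (i : Fin n → Γ.I) (c : Fin n → ℕ) (i' : Fin n' → Γ.I) (c' : Fin n' → ℕ) :
    mulAt ε (flagFun k p r R i c) (flagFun k p r R i' c') x =
      ((ε ^ (-(Γ.m (wt i c) (wt i' c') : ℤ)) : Rˣ) : R) *
        flagCount x (Fin.append i i') (Fin.append c c') := by
  unfold mulAt
  rw [← finsum_flagCount_mul, ← Nat.coe_castAddMonoidHom (α := R),
    AddMonoidHom.map_finsum _ (Set.toFinite _), mul_finsum' _ _ (Set.toFinite _)]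
  refine finsum_congr fun W => ?_
  rw [ev_flagFun, ev_flagFun, Nat.coe_castAddMonoidHom, Nat.cast_mul]
  -- Whenever the term is nonzero, flags exist and force the dimensions of `V / W` and `W`; so the
  -- power of `ε` is the same in all terms that matter.
  by_cases h : flagCount (quot x W.1 W.2) i c = 0
  · simp [h]
  by_cases h' : flagCount (restr x W.1 W.2) i' c' = 0
  · simp [h']
  obtain ⟨⟨A, hA⟩⟩ := (Nat.card_ne_zero.1 h).1
  obtain ⟨⟨B, hB⟩⟩ := (Nat.card_ne_zero.1 h').1
  rw [hA.dim_eq, hB.dim_eq]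
  rfl

theorem mul_flagFun [NeZero r] (ε : Rˣ)
    {n n' : ℕ} (i : Fin n → Γ.I) (c : Fin n → ℕ) (i' : Fin n' → Γ.I) (c' : Fin n' → ℕ) :
    Γ.mul k p r ε (flagFun k p r R i c) (flagFun k p r R i' c') =
      ((ε ^ (-(Γ.m (wt i c) (wt i' c') : ℤ)) : Rˣ) : R) •
        flagFun k p r R (Fin.append i i') (Fin.append c c') :=
  Subtype.ext (funext fun _ => funext fun x => mulAt_flagFun ε x i c i' c')

omit [Fintype J] [Fintype H] in
-- For the empty type the conditions read `V = V^0 = 0`. The unit thus becomes a flag function, and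
-- its statements follow from the general ones.
theorem flagFun_elim0 (i : Fin 0 → Γ.I) (c : Fin 0 → ℕ) [Finite J] [NeZero r] :
    flagFun k p r R i c = Γ.one k p r R := by
  classical
  refine Subtype.ext (funext fun ν => funext fun x => ?_)
  change (flagCount x i c : R) = if ν = 0 then 1 else 0
  split_ifs with h
  · subst h
    have : Unique {F : Fin (0 + 1) → Γ.GrSub k p r (Γ.Std k p r 0) // IsFlag x i c F} := by
      have : Subsingleton (Γ.GrSub k p r (Γ.Std k p r 0)) := by
        refine ⟨fun A B => funext fun i => ?_⟩
        have : Subsingleton (Γ.Std k p r 0 i) := inferInstanceAs (Subsingleton (Fin 0 → _))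
        exact Subsingleton.elim _ _
      refine ⟨⟨⟨fun _ => ⊥, Subsingleton.elim _ _, rfl, fun _ => ?_, fun a => a.elim0⟩⟩,
        fun F => Subtype.ext (Subsingleton.elim _ _)⟩
      intro κ c v hv
      rw [(Submodule.mem_bot _).1 hv, TensorProduct.tmul_zero, map_zero]
      exact zero_mem _
    rw [flagCount, Nat.card_unique, Nat.cast_one]
  · have : IsEmpty {F : Fin (0 + 1) → Γ.GrSub k p r (Γ.Std k p r ν) // IsFlag x i c F} := by
      refine ⟨fun F => h ?_⟩
      have := F.2.dim_eq
      rw [dim_std] at this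
      rw [this]
      funext j
      simp
    rw [flagCount, Nat.card_of_isEmpty, Nat.cast_zero]

end Product

end AutQuiver

namespace AutQuiver

section Algebra

variable {J : Type v} {H : Type w} {Γ : AutQuiver J H}

/-! ### Rescaling of the exponents -/

theorem wt_mul {n : ℕ} (ℓ : ℕ) (i : Fin n → Γ.I) (c : Fin n → ℕ) (j : Γ.I) :
    wt i (fun a => ℓ * c a) j = ℓ * wt i c j := by
  simp only [wt, Finset.mul_sum, mul_ite, mul_zero]

/-- Bilinearity of `m` is the source of the exponent in the requirement `ε₁ ^ (ℓ * ℓ) = ε₂`. -/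
theorem m_mul [Fintype J] [Fintype H] (ℓ : ℕ) (ν μ : Γ.I → ℕ) :
    Γ.m (fun j => ℓ * ν j) (fun j => ℓ * μ j) = ℓ * ℓ * Γ.m ν μ := by
  simp only [m, mul_add, Finset.mul_sum, mul_mul_mul_comm]

theorem N_mul [Fintype J] [Fintype H] {n : ℕ} (ℓ : ℕ) (i : Fin n → Γ.I) (c : Fin n → ℕ) :
    Γ.N i (fun a => ℓ * c a) = ℓ * ℓ * Γ.N i c := by
  simp only [N, mul_add, Finset.mul_sum, mul_ite, mul_zero, mul_mul_mul_comm]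

variable {k : Type u} [Field k] {p : ℕ} [Fact p.Prime] [CharP k p] {r : ℕ} {R : Type} [CommRing R]

/-! ### The composition algebra -/

theorem flagFun_mem_compAlg {n : ℕ} (i : Fin n → Γ.I) (c : Fin n → ℕ) :
    flagFun k p r R i c ∈ Γ.compAlg k p r R := Submodule.subset_span ⟨n, i, c, rfl⟩

theorem one_mem_compAlg [Finite J] [NeZero r] : Γ.one k p r R ∈ Γ.compAlg k p r R := by
  rw [← flagFun_elim0 (fun a => a.elim0) (fun a => a.elim0)]
  exact flagFun_mem_compAlg _ _

variable [Fintype J] [Fintype H]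

theorem mul_mem_compAlg [NeZero r] (ε : Rˣ) {f g : Hall Γ k p r R} (hf : f ∈ Γ.compAlg k p r R)
    (hg : g ∈ Γ.compAlg k p r R) : Γ.mul k p r ε f g ∈ Γ.compAlg k p r R := by
  refine LinearMap.BilinMap.apply_apply_mem_of_mem_span _ _ _ (Γ.mul k p r ε) ?_ f g hf hg
  rintro _ ⟨n, i, c, rfl⟩ _ ⟨n', i', c', rfl⟩
  rw [mul_flagFun]
  exact Submodule.smul_mem _ _ (flagFun_mem_compAlg _ _)

variable {ℓ : ℕ} [NeZero r] [NeZero ℓ] [IsAlgClosed k]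

theorem frobQ_flagFun (hd : ∀ i, Nat.Coprime ℓ (Γ.d i)) (he : ∀ κ, Nat.Coprime ℓ (Γ.e κ))
    (hR : (((Polynomial.cyclotomic ℓ ℤ).eval ((p ^ r : ℕ) : ℤ) : ℤ) : R) = 0) {n : ℕ}
    (i : Fin n → Γ.I) {c : Fin n → ℕ} (hc : ∀ a, ℓ ∣ c a) :
    Γ.frobQ k p r R ℓ (flagFun k p r R i c) = flagFun k p (r * ℓ) R i (fun a => c a / ℓ) := by
  rw [← frobQ_flagFun_mul hd he hR]
  congr 2
  exact funext fun a => (Nat.mul_div_cancel' (hc a)).symm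

theorem frobQ_mem_compAlg (hd : ∀ i, Nat.Coprime ℓ (Γ.d i)) (he : ∀ κ, Nat.Coprime ℓ (Γ.e κ))
    (hR : (((Polynomial.cyclotomic ℓ ℤ).eval ((p ^ r : ℕ) : ℤ) : ℤ) : R) = 0)
    {f : Hall Γ k p r R} (hf : f ∈ Γ.compAlg k p r R) :
    Γ.frobQ k p r R ℓ f ∈ Γ.compAlg k p (r * ℓ) R := by
  refine (Submodule.span_le (p := (Γ.compAlg k p (r * ℓ) R).comap (Γ.frobQ k p r R ℓ))).2 ?_ hf
  rintro _ ⟨n, i, c, rfl⟩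
  change Γ.frobQ k p r R ℓ (flagFun k p r R i c) ∈ Γ.compAlg k p (r * ℓ) R
  by_cases hc : ∀ a, ℓ ∣ c a
  · rw [frobQ_flagFun hd he hR i hc]
    exact flagFun_mem_compAlg _ _
  · rw [frobQ_flagFun_eq_zero hd hR i (not_forall.1 hc)]
    exact zero_mem _

theorem frobQ_mul_flagFun (hd : ∀ i, Nat.Coprime ℓ (Γ.d i)) (he : ∀ κ, Nat.Coprime ℓ (Γ.e κ))
    (hR : (((Polynomial.cyclotomic ℓ ℤ).eval ((p ^ r : ℕ) : ℤ) : ℤ) : R) = 0)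
    {ε₁ ε₂ : Rˣ} (hε : ε₁ ^ (ℓ * ℓ) = ε₂)
    {n n' : ℕ} (i : Fin n → Γ.I) (c : Fin n → ℕ) (i' : Fin n' → Γ.I) (c' : Fin n' → ℕ) :
    Γ.frobQ k p r R ℓ (Γ.mul k p r ε₁ (flagFun k p r R i c) (flagFun k p r R i' c')) =
      Γ.mul k p (r * ℓ) ε₂ (Γ.frobQ k p r R ℓ (flagFun k p r R i c))
        (Γ.frobQ k p r R ℓ (flagFun k p r R i' c')) := by
  rw [mul_flagFun, map_smul]
  by_cases hc : ∀ a, ℓ ∣ c a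
  · by_cases hc' : ∀ a, ℓ ∣ c' a
    · choose b hb using hc
      choose b' hb' using hc'
      obtain rfl : c = fun a => ℓ * b a := funext hb
      obtain rfl : c' = fun a => ℓ * b' a := funext hb'
      have happ : Fin.append (fun a => ℓ * b a) (fun a => ℓ * b' a) =
          fun a => ℓ * Fin.append b b' a := by
        funext a
        refine Fin.addCases (fun a => ?_) (fun a => ?_) a <;> simp
      rw [happ, frobQ_flagFun_mul hd he hR, frobQ_flagFun_mul hd he hR, frobQ_flagFun_mul hd he hR,
        mul_flagFun, funext (wt_mul ℓ i b), funext (wt_mul ℓ i' b'), m_mul, ← hε]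
      congr 2
      rw [zpow_neg, zpow_neg, zpow_natCast, zpow_natCast, pow_mul]
    -- An entry not divisible by `ℓ` remains one in the concatenated type, so both sides vanish.
    · rw [frobQ_flagFun_eq_zero hd hR i' (not_forall.1 hc'), map_zero,
        frobQ_flagFun_eq_zero hd hR, smul_zero]
      obtain ⟨a, ha⟩ := not_forall.1 hc'
      exact ⟨Fin.natAdd n a, by rwa [Fin.append_right]⟩
  · rw [frobQ_flagFun_eq_zero hd hR i (not_forall.1 hc), map_zero, LinearMap.zero_apply,
      frobQ_flagFun_eq_zero hd hR, smul_zero]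
    obtain ⟨a, ha⟩ := not_forall.1 hc
    exact ⟨Fin.castAdd n' a, by rwa [Fin.append_left]⟩

/-- Both sides are linear in `f` and in `g`, so it suffices to compare them on flag functions, one
argument at a time. -/
theorem frobQ_mul (hd : ∀ i, Nat.Coprime ℓ (Γ.d i)) (he : ∀ κ, Nat.Coprime ℓ (Γ.e κ))
    (hR : (((Polynomial.cyclotomic ℓ ℤ).eval ((p ^ r : ℕ) : ℤ) : ℤ) : R) = 0)
    {ε₁ ε₂ : Rˣ} (hε : ε₁ ^ (ℓ * ℓ) = ε₂) {f g : Hall Γ k p r R}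
    (hf : f ∈ Γ.compAlg k p r R) (hg : g ∈ Γ.compAlg k p r R) :
    Γ.frobQ k p r R ℓ (Γ.mul k p r ε₁ f g) =
      Γ.mul k p (r * ℓ) ε₂ (Γ.frobQ k p r R ℓ f) (Γ.frobQ k p r R ℓ g) := by
  refine LinearMap.eqOn_span (f := Γ.frobQ k p r R ℓ ∘ₗ (Γ.mul k p r ε₁).flip g)
    (g := (Γ.mul k p (r * ℓ) ε₂).flip (Γ.frobQ k p r R ℓ g) ∘ₗ Γ.frobQ k p r R ℓ) ?_ hf
  rintro _ ⟨n, i, c, rfl⟩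
  refine LinearMap.eqOn_span
    (f := Γ.frobQ k p r R ℓ ∘ₗ Γ.mul k p r ε₁ (flagFun k p r R i c))
    (g := Γ.mul k p (r * ℓ) ε₂ (Γ.frobQ k p r R ℓ (flagFun k p r R i c)) ∘ₗ Γ.frobQ k p r R ℓ) ?_ hg
  rintro _ ⟨n', i', c', rfl⟩
  exact frobQ_mul_flagFun hd he hR hε i c i' c'

theorem frobQ_one (hd : ∀ i, Nat.Coprime ℓ (Γ.d i)) (he : ∀ κ, Nat.Coprime ℓ (Γ.e κ))
    (hR : (((Polynomial.cyclotomic ℓ ℤ).eval ((p ^ r : ℕ) : ℤ) : ℤ) : R) = 0) :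
    Γ.frobQ k p r R ℓ (Γ.one k p r R) = Γ.one k p (r * ℓ) R := by
  rw [← flagFun_elim0 (fun a => a.elim0) (fun a => a.elim0),
    frobQ_flagFun hd he hR _ fun a => a.elim0, flagFun_elim0]

theorem frobQ_theta (hd : ∀ i, Nat.Coprime ℓ (Γ.d i)) (he : ∀ κ, Nat.Coprime ℓ (Γ.e κ))
    (hR : (((Polynomial.cyclotomic ℓ ℤ).eval ((p ^ r : ℕ) : ℤ) : ℤ) : R) = 0)
    {ε₁ ε₂ : Rˣ} (hε : ε₁ ^ (ℓ * ℓ) = ε₂) {n : ℕ} (i : Fin n → Γ.I) {c : Fin n → ℕ}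
    (hc : ∀ a, ℓ ∣ c a) :
    Γ.frobQ k p r R ℓ (theta k p r ε₁ i c) = theta k p (r * ℓ) ε₂ i (fun a => c a / ℓ) := by
  have hN : Γ.N i c = ℓ * ℓ * Γ.N i (fun a => c a / ℓ) := by
    rw [← N_mul]
    exact congrArg _ (funext fun a => (Nat.mul_div_cancel' (hc a)).symm)
  rw [theta, theta, map_smul, frobQ_flagFun hd he hR i hc, ← hε, hN, zpow_neg, zpow_neg,
    zpow_natCast, zpow_natCast, pow_mul]

theorem frobQ_theta_eq_zero (hd : ∀ i, Nat.Coprime ℓ (Γ.d i))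
    (hR : (((Polynomial.cyclotomic ℓ ℤ).eval ((p ^ r : ℕ) : ℤ) : ℤ) : R) = 0)
    (ε : Rˣ) {n : ℕ} (i : Fin n → Γ.I) {c : Fin n → ℕ} (hc : ∃ a, ¬ ℓ ∣ c a) :
    Γ.frobQ k p r R ℓ (theta k p r ε i c) = 0 := by
  rw [theta, map_smul, frobQ_flagFun_eq_zero hd hR i hc, smul_zero]

end Algebra

end AutQuiver

/-! ### The homomorphism `Q` over `𝒜_ℓ`. -/

theorem theorem4p3 {J H : Type*} [Fintype J] [Fintype H] (Γ : AutQuiver J H)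
    (k : Type*) [Field k] [IsAlgClosed k] (p : ℕ) [Fact p.Prime] [CharP k p]
    (r ℓ : ℕ) [NeZero r] [NeZero ℓ] (hpℓ : ¬ p ∣ ℓ)
    (hd : ∀ i, Nat.Coprime ℓ (Γ.d i)) (he : ∀ κ, Nat.Coprime ℓ (Γ.e κ))
    (ε : ℝˣ) (hε : (ε : ℝ) ^ 2 = (p : ℝ) ^ r) :
    let R := cycloRing ε ℓ
    let ε₁ : Rˣ := cycloUnit ε ℓ
    let ε₂ : Rˣ := (-1) ^ (ℓ + 1) * ε₁ ^ ℓ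
    let F := Γ.compAlg k p r R
    let F' := Γ.compAlg k p (r * ℓ) R
    let Q := Γ.frobQ k p r R ℓ
    -- `F` and `F'` are subalgebras for the twisted multiplications
    (Γ.one k p r R ∈ F ∧ ∀ f ∈ F, ∀ g ∈ F, Γ.mul k p r ε₁ f g ∈ F) ∧
    (Γ.one k p (r * ℓ) R ∈ F' ∧ ∀ f ∈ F', ∀ g ∈ F', Γ.mul k p (r * ℓ) ε₂ f g ∈ F') ∧
    -- the linear map `Q` restricts to an algebra homomorphism `F → F'`
    (∀ f ∈ F, Q f ∈ F') ∧
    Q (Γ.one k p r R) = Γ.one k p (r * ℓ) R ∧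
    (∀ f ∈ F, ∀ g ∈ F, Q (Γ.mul k p r ε₁ f g) = Γ.mul k p (r * ℓ) ε₂ (Q f) (Q g)) ∧
    -- the values of `Q` on the normalized flag functions
    (∀ (n : ℕ) (i : Fin n → Γ.I) (c : Fin n → ℕ), (∀ a, ℓ ∣ c a) →
      Q (AutQuiver.theta k p r ε₁ i c) = AutQuiver.theta k p (r * ℓ) ε₂ i (fun a => c a / ℓ)) ∧
    (∀ (n : ℕ) (i : Fin n → Γ.I) (c : Fin n → ℕ), (∃ a, ¬ ℓ ∣ c a) →
      Q (AutQuiver.theta k p r ε₁ i c) = 0) := by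
  intro R ε₁ ε₂ F F' Q
  -- Of the coefficient ring only two facts enter: `Φ_ℓ(q) = 0`, for the flag counts, and `ε ^ (ℓ *
  -- ℓ) = ε_ℓ`, for the normalizations.
  have hR : (((Polynomial.cyclotomic ℓ ℤ).eval ((p ^ r : ℕ) : ℤ) : ℤ) : R) = 0 :=
    cycloRing_cyclotomic_eval ℓ (by rw [hε, Nat.cast_pow])
  have hε' : ε₁ ^ (ℓ * ℓ) = ε₂ :=
    Units.pow_mul_self_of_pow_eq_neg_one (cycloUnit_pow ε (NeZero.ne ℓ))
  exact ⟨⟨AutQuiver.one_mem_compAlg, fun f hf g hg => AutQuiver.mul_mem_compAlg ε₁ hf hg⟩,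
    ⟨AutQuiver.one_mem_compAlg, fun f hf g hg => AutQuiver.mul_mem_compAlg ε₂ hf hg⟩,
    fun f hf => AutQuiver.frobQ_mem_compAlg hd he hR hf,
    AutQuiver.frobQ_one hd he hR,
    fun f hf g hg => AutQuiver.frobQ_mul hd he hR hε' hf hg,
    fun n i c hc => AutQuiver.frobQ_theta hd he hR hε' i hc,
    fun n i c hc => AutQuiver.frobQ_theta_eq_zero hd hR ε₁ i hc⟩
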